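/- Let $\Pi$ be an indecomposable (finite, reduced, crystallographic) root system in a vector space $V$ over a field of characteristic $0$, with a set $\Delta$ of simple roots, positive roots $\Pi_+$, Weyl group $W$ and longest element $w_0\in W$ (with respect to the simple reflections $s_\alpha$, $\alpha\in\Delta$). Order the roots by $\alpha\le\beta$ iff $\beta-\alpha\in\mathbb{Z}_{\ge 0}\Delta$. For $u\in W$ let $\Gamma(u)$ be the directed graph (loops allowed) with vertex set $u(\Pi_+)\cap\Pi_+$ and an edge $\alpha\to\beta$ iff $u^{-1}(\alpha)\le\beta$; call $u$ *rational* if $\Gamma(u)$ has no directed cycle (a loop counts as a cycle). Let $\Gamma(W)$ be the graph whose vertices are the rational elements of $W$, where $u$ and $v$ are joined by an edge iff $u=s_\alpha v$ for some $\alpha\in\Delta$. Theorem 2. (1) The graph $\Gamma(W)$ is connected. (2) $w_0$ is a vertex of $\Gamma(W)$, and $\Gamma(W)$ carries a $\mathbb{Z}_2$-symmetry centered at $w_0$: the map $\epsilon=-w_0$ is an involutive permutation of $\Delta$ that preserves the Cartan matrix, it induces an automorphism $\epsilon$ of $W$ with $\epsilon(s_\alpha)=s_{\epsilon(\alpha)}$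 for all $\alpha\in\Delta$, and this automorphism restricts to an automorphism of the graph $\Gamma(W)$ whose square is the identity and whose only fixed vertex is $w_0$. (3) $\Gamma(W)$ has more than one vertex if and only if $w_0\ne-\mathrm{id}_V$; and $w_0\ne-\mathrm{id}_V$ holds exactly in the types $A_r$ ($r\ge 2$), $D_r$ ($r\ge 4$, $r$ odd) and $E_6$. -/

import Mathlib

namespace RootPairing.Base

variable {ι R M N : Type*} [Field R] [CharZero R]
  [AddCommGroup M] [Module R M] [AddCommGroup N] [Module R N]
  {P : RootPairing ι R M N} (b : P.Base)

/-- The simple reflection attached to a simple root, as an element of the Weyl group. -/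
def simpleReflection (i : b.support) : P.weylGroup :=
  RootPairing.weylGroup.ofIdx P i

/-- The length of a Weyl group element: the least number of factors in an expression of `w` as a
product of simple reflections (such expressions always exist). -/
noncomputable def weylLength (w : P.weylGroup) : ℕ :=
  sInf {n | ∃ l : List b.support, l.length = n ∧ (l.map b.simpleReflection).prod = w}

/-- `w` is the longest element of the Weyl group: its length is the largest one that occurs. -/
def IsLongest (w : P.weylGroup) : Prop :=
  ∀ v : P.weylGroup, b.weylLength v ≤ b.weylLength w

/-- The set of (indices of) positive roots. -/
def posRoots : Set ι := {i | b.IsPos i}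

/-- The order on roots: `α ≤ β` iff `β - α` is a sum of simple roots (with repetitions; the empty
sum is allowed). -/
def RootLE (i j : ι) : Prop :=
  P.root j - P.root i ∈ AddSubmonoid.closure (P.root '' b.support)

/-- The set `u(Π₊) ∩ Π₊` of positive roots. -/
def nuZero (u : P.weylGroup) : Set ι :=
  P.weylGroupToPerm u '' b.posRoots ∩ b.posRoots

/-- The rationality graph of `u`: a directed graph, loops allowed, with vertex set
`u(Π₊) ∩ Π₊` and an edge `α → β` iff `u⁻¹(α) ≤ β`. -/
def elementGraph (u : P.weylGroup) : Digraph (b.nuZero u) where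
  Adj α β := b.RootLE (P.weylGroupToPerm u⁻¹ α) β

/-- `u` is rational if its directed graph has no (directed) cycles; a loop is a cycle. -/
def IsRational (u : P.weylGroup) : Prop :=
  ∀ α : b.nuZero u, ¬ Relation.TransGen (b.elementGraph u).Adj α α

theorem simpleReflection_mul_self (i : b.support) :
    b.simpleReflection i * b.simpleReflection i = 1 := by
  apply Subtype.ext
  have h := RootPairing.Equiv.reflection_inv P i
  change RootPairing.Equiv.reflection P i * RootPairing.Equiv.reflection P i = 1
  nth_rewrite 1 [← h]
  exact inv_mul_cancel _

theorem simpleReflection_ne_one (i : b.support) : b.simpleReflection i ≠ 1 := by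
  intro h
  have h1 : b.simpleReflection i • P.root i = P.root i := by rw [h, one_smul]
  have h2 : b.simpleReflection i • P.root i = -P.root i :=
    P.reflection_apply_self i
  have h3 : P.root i = -P.root i := h1.symm.trans h2
  have h4 : (2 : R) • P.root i = 0 := by
    rw [two_smul]; nth_rewrite 1 [h3]; exact neg_add_cancel _
  exact P.ne_zero i ((smul_eq_zero.mp h4).resolve_left two_ne_zero)

/-- The rationality graph of the Weyl group: its vertices are the rational elements, and `u`, `v`
are joined by an edge iff `u = s v` for a simple reflection `s`. -/
def rationalityGraph : SimpleGraph {u : P.weylGroup // b.IsRational u} where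
  Adj u v := ∃ i : b.support, (u : P.weylGroup) = b.simpleReflection i * v
  symm := ⟨by
    rintro u v ⟨i, h⟩
    exact ⟨i, by rw [h, ← mul_assoc, simpleReflection_mul_self, one_mul]⟩⟩
  loopless := ⟨by
    rintro u ⟨i, h⟩
    exact b.simpleReflection_ne_one i (mul_eq_right.mp h.symm)⟩

/-- The root system has the type given by the Cartan matrix `C`: the simple roots can be numbered
so that its Cartan matrix becomes `C`. -/
def HasCartanType [P.IsCrystallographic] {r : ℕ} (C : Matrix (Fin r) (Fin r) ℤ) : Prop :=
  ∃ e : b.support ≃ Fin r, ∀ i j, b.cartanMatrix i j = C (e i) (e j)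

end RootPairing.Base

/-!
The rational elements and the type of the root system are compared through the opposition
involution `ε = -w₀` (`simpleOpposition`, and `opposition` on all roots), which acts on the Weyl
group as conjugation with `w₀`. Since `-w₀` preserves positivity and the order of roots, conjugation
with `w₀` preserves rationality and is an automorphism of the rationality graph.

*Removing simple reflections.* Suppose that the graph of `u` has no cycle. If `u ≠ w₀`, a minimal
vertex of the graph yields a simple root `a` with `u⁻¹ a > 0` and `u a < 0`
(`IsStronglyRational.exists_simple`), and then the graph of `s_a u` has fewer vertices and again no
cycle (`IsStronglyRational.simpleReflection_mul`): a cycle of `s_a u` is carried to a cycle of `u` by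
applying `s_a` to its vertices, suitably corrected where `a` pairs positively. For the correction an
inequality `i ≤ j` has to survive the passage from `j` to `s_a j`. This fails for double and triple
bonds, but holds for the finer order `StrongLE`, which compares roots and coroots simultaneously. So
the argument is carried out for *strongly rational* elements, those without cycles for `StrongLE`.
Every rational element is strongly rational, and for simply laced systems the two notions agree.

*Fixed vertices.* Let `u` be strongly rational and commute with `w₀`. Removing `a` and `ε a`
symmetrically (that is, multiplying by the longest element of the subgroup generated by `s_a` and
`s_{ε a}`) gives a smaller element of the same kind, which is `w₀` by induction. But then `u` is
explicit, and its graph has a loop or a cycle of length two. Hence `w₀` is the only fixed vertex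
(`IsStronglyRational.eq_longest_of_conj_eq`). If `w₀ = -1`, all vertices are fixed and `w₀` is the
only vertex; if `ε a ≠ a`, then `s_a w₀` is a second vertex.

*Connectedness.* If `w₀ = -1`, there is one vertex. Otherwise the classification below shows that the
system is simply laced, so removing simple reflections stays among the rational elements and joins
every vertex to `w₀`.

*Classification.* The Weyl group acts trivially on weights modulo the root lattice, so `-w₀` acts by
`-1` there (`dvd_simpleOpposition_add`). This shows `w₀ ≠ -1` in the types `A r` (`r ≥ 2`), `D r` (`r`
odd) and `E₆`, and that `-w₀` cannot exchange the ends of the fork in type `D r` for even `r`.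
Conversely, if `ε` moves a simple root, then, the Dynkin diagram being a tree, there is a path of type
`A n` with `n ≥ 2` that `ε` reverses; take a maximal one. Positive definiteness excludes diagrams of
affine type (`exists_sum_pairingIn_pos`), where parts of the path are contracted to a single root
(`IsPathA.exists_contraction`) in order to treat the infinite families at once. What remains is that a
simple root outside the path is attached to its middle by a single bond, which leads to `D r` for
`n = 3`, to `E₆` for `n = 5` and to a contradiction for `n ≥ 7`; without such a root the type is `A n`.
-/

set_option linter.unusedSectionVars false


namespace RootPairing.Base

variable {ι R M N : Type*} [Field R]
  [AddCommGroup M] [Module R M] [AddCommGroup N] [Module R N]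
  {P : RootPairing ι R M N} (b : P.Base)

/-! ### The Weyl group acting on roots -/

lemma root_smul (u : P.weylGroup) (i : ι) : P.root (u • i) = u • P.root i :=
  (P.weylGroup_apply_root u i).symm

lemma simpleReflection_smul (i : b.support) (j : ι) :
    b.simpleReflection i • j = P.reflectionPerm i j := rfl

lemma simpleReflection_smul_smul (i : b.support) (j : ι) :
    b.simpleReflection i • b.simpleReflection i • j = j := by
  simp [simpleReflection_smul]

lemma pairing_smul_smul (u : P.weylGroup) (i j : ι) :
    P.pairing (u • i) (u • j) = P.pairing i j := by
  obtain ⟨u, hu⟩ := u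
  induction hu using weylGroup.induction generalizing i j with
  | mem k =>
    change P.pairing (P.reflectionPerm k i) (P.reflectionPerm k j) = _
    simp [pairing_reflectionPerm]
  | one => rfl
  | mul x y hx hy ihx ihy => exact (ihx _ _).trans (ihy i j)

lemma smul_reflectionPerm (u : P.weylGroup) (i j : ι) :
    u • P.reflectionPerm i j = P.reflectionPerm (u • i) (u • j) := by
  apply P.root.injective
  rw [root_smul, root_reflectionPerm, root_reflectionPerm, reflection_apply_root,
    reflection_apply_root, pairing_smul_smul, smul_sub, smul_comm, root_smul, root_smul]

lemma weylGroup_ext [P.IsRootSystem] {u v : P.weylGroup}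
    (h : ∀ i : b.support, u • (i : ι) = v • (i : ι)) : u = v := by
  apply Subtype.ext
  apply RootPairing.Equiv.weightHom_injective
  apply LinearEquiv.toLinearMap_injective
  refine b.toWeightBasis.ext fun i ↦ ?_
  rw [b.toWeightBasis_apply]
  change u • P.root i = v • P.root i
  rw [← root_smul, ← root_smul, h i]

lemma conj_ofIdx [P.IsRootSystem] (u : P.weylGroup) (i : ι) :
    u * weylGroup.ofIdx P i * u⁻¹ = weylGroup.ofIdx P (u • i) := by
  apply Subtype.ext
  apply RootPairing.Equiv.weightHom_injective
  apply LinearEquiv.toLinearMap_injective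
  refine LinearMap.ext_on (IsRootSystem.span_root_eq_top (P := P)) ?_
  rintro - ⟨j, rfl⟩
  change (u * weylGroup.ofIdx P i * u⁻¹) • P.root j = weylGroup.ofIdx P (u • i) • P.root j
  rw [← root_smul, ← root_smul, mul_smul, mul_smul]
  congr 1
  change u • P.reflectionPerm i _ = P.reflectionPerm (u • i) j
  rw [smul_reflectionPerm, smul_inv_smul]

lemma weylLength_le_length (l : List b.support) :
    b.weylLength (l.map b.simpleReflection).prod ≤ l.length :=
  Nat.sInf_le ⟨l, rfl, rfl⟩

/-! ### Coordinates of a root in the simple roots -/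

variable [CharZero R]

/-- The coefficient of the simple root `k` in the root `i`. -/
noncomputable def coeff (i : ι) (k : b.support) : ℤ :=
  b.toWeightBasisInt.repr (P.rootSpanMem ℤ i) k

lemma sum_coeff_smul_root (i : ι) : ∑ k, b.coeff i k • P.root k = P.root i := by
  have h := congrArg (Subtype.val) (b.toWeightBasisInt.sum_repr (P.rootSpanMem ℤ i))
  simpa [coeff] using h

lemma coeff_unique {i : ι} {f : b.support → ℤ} (h : ∑ k, f k • P.root k = P.root i)
    (k : b.support) : b.coeff i k = f k := by
  have hli : LinearIndependent ℤ (fun k : b.support ↦ P.root k) :=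
    b.linearIndepOn_root.restrict_scalars' ℤ
  exact Fintype.linearIndependent_iffₛ.mp hli (b.coeff i) f
    (by rw [h]; exact b.sum_coeff_smul_root i) k

lemma coeff_simple [DecidableEq b.support] (i k : b.support) :
    b.coeff i k = if k = i then 1 else 0 :=
  b.coeff_unique (f := fun k ↦ if k = i then 1 else 0) (by simp [ite_smul]) k

lemma sum_smul_root_mem_closure_iff (f : b.support → ℤ) :
    ∑ k, f k • P.root k ∈ AddSubmonoid.closure (P.root '' b.support) ↔ ∀ k, 0 ≤ f k := by
  constructor
  · intro h
    rw [← Submodule.span_nat_eq_addSubmonoidClosure, Submodule.mem_toAddSubmonoid,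
      Fintype.mem_span_image_iff_exists_fun] at h
    obtain ⟨c, hc⟩ := h
    have hli : LinearIndependent ℤ (fun k : b.support ↦ P.root k) :=
      b.linearIndepOn_root.restrict_scalars' ℤ
    have := Fintype.linearIndependent_iffₛ.mp hli (fun k ↦ (c k : ℤ)) f
      (by simp only [natCast_zsmul]; exact hc)
    intro k
    rw [← this k]
    positivity
  · intro h
    refine sum_mem fun k _ ↦ ?_
    obtain ⟨n, hn⟩ := Int.eq_ofNat_of_zero_le (h k)
    rw [hn, natCast_zsmul]
    exact nsmul_mem (AddSubmonoid.subset_closure (Set.mem_image_of_mem _ k.2)) n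

lemma rootLE_iff {i j : ι} : b.RootLE i j ↔ ∀ k, b.coeff i k ≤ b.coeff j k := by
  have h : P.root j - P.root i = ∑ k, (b.coeff j k - b.coeff i k) • P.root k := by
    simp only [sub_smul, Finset.sum_sub_distrib, sum_coeff_smul_root]
  rw [RootLE, h, sum_smul_root_mem_closure_iff]
  simp

lemma coeff_nonneg_or (i : ι) : (∀ k, 0 ≤ b.coeff i k) ∨ ∀ k, b.coeff i k ≤ 0 := by
  rcases b.root_mem_or_neg_mem i with h | h
  · rw [← b.sum_coeff_smul_root i, sum_smul_root_mem_closure_iff] at h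
    exact .inl h
  · rw [← b.sum_coeff_smul_root i, ← Finset.sum_neg_distrib] at h
    simp only [← neg_smul] at h
    rw [sum_smul_root_mem_closure_iff] at h
    exact .inr fun k ↦ by simpa using h k

lemma height_eq_sum_coeff (i : ι) : b.height i = ∑ k, b.coeff i k := by
  classical
  have h : P.root i = ∑ j ∈ b.support,
      (fun j ↦ if h : j ∈ b.support then b.coeff i ⟨j, h⟩ else 0 : ι → ℤ) j • P.root j := by
    rw [b.support.sum_subtype (p := (· ∈ b.support)) (by simp) (F := inferInstance),
      ← b.sum_coeff_smul_root i]
    exact Finset.sum_congr rfl fun x _ ↦ by simp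
  rw [height_eq_sum h, b.support.sum_subtype (p := (· ∈ b.support)) (by simp) (F := inferInstance)]
  exact Finset.sum_congr rfl fun x _ ↦ by simp

lemma isPos_iff_coeff {i : ι} : b.IsPos i ↔ ∀ k, 0 ≤ b.coeff i k := by
  constructor
  · intro h
    refine (b.coeff_nonneg_or i).resolve_right fun h' ↦ ?_
    rw [isPos_iff, height_eq_sum_coeff] at h
    exact absurd h (not_lt.mpr (Finset.sum_nonpos fun k _ ↦ h' k))
  · intro h
    rw [isPos_iff', height_eq_sum_coeff]
    exact Finset.sum_nonneg fun k _ ↦ h k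

lemma not_isPos_iff_coeff {i : ι} : ¬ b.IsPos i ↔ ∀ k, b.coeff i k ≤ 0 := by
  constructor
  · intro h
    exact (b.coeff_nonneg_or i).resolve_left fun h' ↦ h (b.isPos_iff_coeff.mpr h')
  · intro h h'
    rw [isPos_iff, height_eq_sum_coeff] at h'
    exact absurd h' (not_lt.mpr (Finset.sum_nonpos fun k _ ↦ h k))

lemma IsPos.exists_coeff_pos {b : P.Base} {i : ι} (h : b.IsPos i) : ∃ k, 0 < b.coeff i k := by
  by_contra! h'
  exact b.not_isPos_iff_coeff.mpr h' h

lemma isPos_simple (i : b.support) : b.IsPos i := isPos_of_mem_support i.2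

lemma isPos_reflectionPerm_self_iff (i : ι) : b.IsPos (P.reflectionPerm i i) ↔ ¬ b.IsPos i :=
  IsPos.neg_iff_not b i

lemma coeff_smul (u : P.weylGroup) (i : ι) (k : b.support) :
    b.coeff (u • i) k = ∑ j, b.coeff i j * b.coeff (u • (j : ι)) k := by
  refine b.coeff_unique (f := fun k ↦ ∑ j, b.coeff i j * b.coeff (u • (j : ι)) k) ?_ k
  rw [root_smul, ← b.sum_coeff_smul_root i, Finset.smul_sum]
  simp only [Finset.sum_smul, mul_smul]
  rw [Finset.sum_comm]
  refine Finset.sum_congr rfl fun j _ ↦ ?_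
  rw [← Finset.smul_sum, sum_coeff_smul_root, root_smul]
  exact ((DistribSMul.toAddMonoidHom M u).map_zsmul _ _).symm

/-- A positive root sent by `u` to a negative (positive) root involves a simple root with the same
property. -/
lemma IsPos.exists_simple_smul {b : P.Base} {i : ι} (hi : b.IsPos i) (u : P.weylGroup) :
    (b.IsPos (u • i) → ∃ k : b.support, 0 < b.coeff i k ∧ b.IsPos (u • (k : ι))) ∧
    (¬ b.IsPos (u • i) → ∃ k : b.support, 0 < b.coeff i k ∧ ¬ b.IsPos (u • (k : ι))) := by
  constructor
  · intro h
    by_contra! h'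
    refine b.not_isPos_iff_coeff.mpr (fun k ↦ ?_) h
    rw [coeff_smul]
    refine Finset.sum_nonpos fun j _ ↦ ?_
    rcases (b.isPos_iff_coeff.mp hi j).eq_or_lt with h0 | h0
    · simp [← h0]
    · exact mul_nonpos_of_nonneg_of_nonpos h0.le (b.not_isPos_iff_coeff.mp (h' j h0) k)
  · intro h
    by_contra! h'
    refine h (b.isPos_iff_coeff.mpr (fun k ↦ ?_))
    rw [coeff_smul]
    refine Finset.sum_nonneg fun j _ ↦ ?_
    rcases (b.isPos_iff_coeff.mp hi j).eq_or_lt with h0 | h0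
    · simp [← h0]
    · exact mul_nonneg h0.le (b.isPos_iff_coeff.mp (h' j h0) k)

section Crystallographic

variable [P.IsCrystallographic]

lemma pairingIn_smul_smul (u : P.weylGroup) (i j : ι) :
    P.pairingIn ℤ (u • i) (u • j) = P.pairingIn ℤ i j := by
  apply FaithfulSMul.algebraMap_injective ℤ R
  simp only [algebraMap_pairingIn, pairing_smul_smul]

lemma coeff_reflectionPerm (i j : ι) (k : b.support) :
    b.coeff (P.reflectionPerm j i) k = b.coeff i k - P.pairingIn ℤ i j * b.coeff j k := by
  refine b.coeff_unique (f := fun k ↦ b.coeff i k - P.pairingIn ℤ i j * b.coeff j k) ?_ k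
  rw [root_reflectionPerm, reflection_apply_root' ℤ]
  simp only [sub_smul, Finset.sum_sub_distrib, mul_smul, ← Finset.smul_sum, sum_coeff_smul_root]

lemma pairingIn_eq_sum (i j : ι) :
    P.pairingIn ℤ i j = ∑ k, b.coeff i k * P.pairingIn ℤ k j := by
  apply FaithfulSMul.algebraMap_injective ℤ R
  simp only [map_sum, map_mul, algebraMap_pairingIn]
  rw [← P.root_coroot'_eq_pairing, ← b.sum_coeff_smul_root i]
  simp

end Crystallographic

/-! ### Words, the exchange condition and the longest element -/

variable [Finite ι] [P.IsCrystallographic] [P.IsReduced]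

lemma isPos_simpleReflection_smul {i : b.support} {j : ι} (hj : b.IsPos j) (hij : j ≠ i) :
    b.IsPos (b.simpleReflection i • j) :=
  hj.reflectionPerm i.2 hij

lemma isPos_simpleReflection_smul_iff {i : b.support} {j : ι} (hij : j ≠ i)
    (hij' : j ≠ P.reflectionPerm i i) :
    b.IsPos (b.simpleReflection i • j) ↔ b.IsPos j := by
  refine ⟨fun h ↦ ?_, fun h ↦ b.isPos_simpleReflection_smul h hij⟩
  rw [← b.simpleReflection_smul_smul i j]
  refine b.isPos_simpleReflection_smul h fun h' ↦ hij' ?_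
  rw [← b.simpleReflection_smul_smul i j, h']
  rfl

variable [P.IsRootSystem]

/-- The simple reflections generate the Weyl group. -/
lemma exists_word (u : P.weylGroup) :
    ∃ l : List b.support, (l.map b.simpleReflection).prod = u := by
  set H : Subgroup P.weylGroup := Subgroup.closure (Set.range b.simpleReflection) with hH
  have key : ∀ i : ι, weylGroup.ofIdx P i ∈ H := by
    intro i
    refine b.induction_reflect i (p := fun i ↦ weylGroup.ofIdx P i ∈ H) ?_ ?_ ?_
    · intro i hi
      have h := conj_ofIdx (P := P) (weylGroup.ofIdx P i) i
      change _ = weylGroup.ofIdx P (P.reflectionPerm i i) at h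
      rw [← h]
      exact H.mul_mem (H.mul_mem hi hi) (H.inv_mem hi)
    · intro i hi
      exact Subgroup.subset_closure ⟨⟨i, hi⟩, rfl⟩
    · intro i j hi hj
      have h := conj_ofIdx (P := P) (b.simpleReflection ⟨j, hj⟩) i
      change _ = weylGroup.ofIdx P (P.reflectionPerm j i) at h
      rw [← h]
      have hj' : b.simpleReflection ⟨j, hj⟩ ∈ H := Subgroup.subset_closure ⟨⟨j, hj⟩, rfl⟩
      exact H.mul_mem (H.mul_mem hj' hi) (H.inv_mem hj')
  have hu : u ∈ H := by
    obtain ⟨u, hu⟩ := u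
    induction hu using weylGroup.induction with
    | mem i => exact key i
    | one => exact H.one_mem
    | mul x y hx hy ihx ihy => exact H.mul_mem ihx ihy
  have hinv : ∀ i, (b.simpleReflection i)⁻¹ = b.simpleReflection i := fun i ↦
    inv_eq_of_mul_eq_one_left (b.simpleReflection_mul_self i)
  induction hu using Subgroup.closure_induction'' with
  | one => exact ⟨[], rfl⟩
  | mem x hx => obtain ⟨i, rfl⟩ := hx; exact ⟨[i], by simp⟩
  | inv_mem x hx => obtain ⟨i, rfl⟩ := hx; exact ⟨[i], by simp [hinv]⟩
  | mul x y _ _ ihx ihy =>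
    obtain ⟨l, rfl⟩ := ihx
    obtain ⟨l', rfl⟩ := ihy
    exact ⟨l ++ l', by simp⟩

/-- The exchange condition: if a word sends the simple root `j` to a negative root, then one letter
can be cancelled against a factor `s_j` on the right. -/
lemma exists_word_mul_simpleReflection (l : List b.support) (j : b.support)
    (h : ¬ b.IsPos ((l.map b.simpleReflection).prod • (j : ι))) :
    ∃ l' : List b.support, l'.length + 1 = l.length ∧
      (l'.map b.simpleReflection).prod = (l.map b.simpleReflection).prod * b.simpleReflection j := by
  induction l with
  | nil => simp [b.isPos_simple j] at h
  | cons i t ih =>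
    by_cases ht : b.IsPos ((t.map b.simpleReflection).prod • (j : ι))
    · have hti : (t.map b.simpleReflection).prod • (j : ι) = i := by
        by_contra hne
        refine h ?_
        rw [List.map_cons, List.prod_cons, mul_smul]
        exact b.isPos_simpleReflection_smul ht hne
      refine ⟨t, rfl, ?_⟩
      have hc := conj_ofIdx (P := P) (t.map b.simpleReflection).prod j
      rw [hti] at hc
      change _ * b.simpleReflection j * _ = b.simpleReflection i at hc
      rw [List.map_cons, List.prod_cons, ← hc]
      simp [mul_assoc, simpleReflection_mul_self]
    · obtain ⟨t', ht', ht''⟩ := ih ht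
      exact ⟨i :: t', by simp [ht'], by simp [ht'', mul_assoc]⟩

/-- The Weyl group acts freely on positive systems. -/
lemma eq_one_of_forall_isPos {u : P.weylGroup} (h : ∀ i : b.support, b.IsPos (u • (i : ι))) :
    u = 1 := by
  obtain ⟨l, rfl⟩ := b.exists_word u
  induction hn : l.length using Nat.strong_induction_on generalizing l with
  | _ n ih =>
    rcases List.eq_nil_or_concat l with rfl | ⟨t, j, rfl⟩
    · rfl
    · have hj : ¬ b.IsPos ((t.map b.simpleReflection).prod • (j : ι)) := by
        have := h j
        simp only [List.concat_eq_append, List.map_append, List.map_cons, List.map_nil,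
          List.prod_append, List.prod_cons, List.prod_nil, mul_one, mul_smul] at this
        rw [simpleReflection_smul, smul_reflectionPerm] at this
        exact (b.isPos_reflectionPerm_self_iff _).mp this
      obtain ⟨l', hl', hl''⟩ := b.exists_word_mul_simpleReflection t j hj
      have he : ((t.concat j).map b.simpleReflection).prod = (l'.map b.simpleReflection).prod := by
        rw [hl'']; simp
      rw [he] at h ⊢
      refine ih l'.length ?_ l' h rfl
      simp at hn
      lia

lemma exists_reduced_word (u : P.weylGroup) :
    ∃ l : List b.support, l.length = b.weylLength u ∧ (l.map b.simpleReflection).prod = u := by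
  obtain ⟨l, hl⟩ := b.exists_word u
  have : {n | ∃ l : List b.support, l.length = n ∧ (l.map b.simpleReflection).prod = u}.Nonempty :=
    ⟨l.length, l, rfl, hl⟩
  exact Nat.sInf_mem this

variable {b}

/-- Otherwise the exchange condition would make `w₀ s_i` longer than `w₀`. -/
lemma IsLongest.not_isPos_smul_simple {w₀ : P.weylGroup} (hw₀ : b.IsLongest w₀) (i : b.support) :
    ¬ b.IsPos (w₀ • (i : ι)) := by
  intro h
  obtain ⟨l, hl, hlw⟩ := b.exists_reduced_word (w₀ * b.simpleReflection i)
  have hneg : ¬ b.IsPos ((l.map b.simpleReflection).prod • (i : ι)) := by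
    rw [hlw, mul_smul, simpleReflection_smul, smul_reflectionPerm, isPos_reflectionPerm_self_iff]
    exact not_not.mpr h
  obtain ⟨l', hl', hlw'⟩ := b.exists_word_mul_simpleReflection l i hneg
  rw [hlw, mul_assoc, simpleReflection_mul_self, mul_one] at hlw'
  have h1 := b.weylLength_le_length l'
  rw [hlw'] at h1
  have h2 := hw₀ (w₀ * b.simpleReflection i)
  lia

lemma IsLongest.isPos_smul_iff {w₀ : P.weylGroup} (hw₀ : b.IsLongest w₀) (i : ι) :
    b.IsPos (w₀ • i) ↔ ¬ b.IsPos i := by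
  have key : ∀ i, b.IsPos i → ¬ b.IsPos (w₀ • i) := by
    intro i hi h
    obtain ⟨k, -, hk⟩ := (hi.exists_simple_smul w₀).1 h
    exact hw₀.not_isPos_smul_simple k hk
  refine ⟨fun h h' ↦ key i h' h, fun h ↦ ?_⟩
  rw [← isPos_reflectionPerm_self_iff] at h
  have := key _ h
  rw [smul_reflectionPerm, isPos_reflectionPerm_self_iff, not_not] at this
  exact this

lemma IsLongest.mul_self {w₀ : P.weylGroup} (hw₀ : b.IsLongest w₀) : w₀ * w₀ = 1 := by
  refine b.eq_one_of_forall_isPos fun i ↦ ?_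
  rw [mul_smul, hw₀.isPos_smul_iff]
  exact hw₀.not_isPos_smul_simple i

/-- The longest element is characterised by sending all simple roots to negative roots. -/
lemma IsLongest.eq_of_forall_simple {w₀ : P.weylGroup} (hw₀ : b.IsLongest w₀) {u : P.weylGroup}
    (hu : ∀ i : b.support, ¬ b.IsPos (u⁻¹ • (i : ι))) : u = w₀ := by
  have key : ∀ i, b.IsPos i → ¬ b.IsPos (u⁻¹ • i) := by
    intro i hi h
    obtain ⟨k, -, hk⟩ := (hi.exists_simple_smul u⁻¹).1 h
    exact hu k hk
  have : u⁻¹ * w₀ = 1 := by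
    refine b.eq_one_of_forall_isPos fun i ↦ ?_
    rw [mul_smul]
    have h1 : b.IsPos (P.reflectionPerm (w₀ • (i : ι)) (w₀ • (i : ι))) := by
      rw [isPos_reflectionPerm_self_iff]
      exact hw₀.not_isPos_smul_simple i
    have h2 := key _ h1
    rw [smul_reflectionPerm, isPos_reflectionPerm_self_iff, not_not] at h2
    exact h2
  exact (eq_of_inv_mul_eq_one this)

end RootPairing.Base

namespace RootPairing.Base

variable {ι R M N : Type*} [Field R] [CharZero R]
  [AddCommGroup M] [Module R M] [AddCommGroup N] [Module R N]
  {P : RootPairing ι R M N} (b : P.Base)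

/-! ### Comparing roots and coroots -/

/-- The coefficient of the simple coroot `k` in the coroot `i`. -/
noncomputable def cocoeff (i : ι) (k : b.support) : ℤ := b.flip.coeff i k

/-- The order on roots that compares the roots and the coroots simultaneously. In the simply laced
case it is the usual order. -/
def StrongLE (i j : ι) : Prop := b.RootLE i j ∧ b.flip.RootLE i j

lemma strongLE_iff {i j : ι} : b.StrongLE i j ↔
    (∀ k, b.coeff i k ≤ b.coeff j k) ∧ ∀ k, b.cocoeff i k ≤ b.cocoeff j k := by
  rw [StrongLE, rootLE_iff, rootLE_iff]
  rfl

lemma StrongLE.refl (i : ι) : b.StrongLE i i := by simp [strongLE_iff]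

variable {b} in
lemma StrongLE.trans {i j k : ι} (h : b.StrongLE i j) (h' : b.StrongLE j k) : b.StrongLE i k := by
  rw [strongLE_iff] at h h' ⊢
  exact ⟨fun l ↦ (h.1 l).trans (h'.1 l), fun l ↦ (h.2 l).trans (h'.2 l)⟩

variable [P.IsCrystallographic]

lemma pairingIn_reflectionPerm_left (i j : ι) :
    P.pairingIn ℤ (P.reflectionPerm j i) j = -P.pairingIn ℤ i j := by
  rw [← pairingIn_reflectionPerm_self_right, pairingIn_reflectionPerm]

lemma pairingIn_flip (i j : ι) : P.flip.pairingIn ℤ i j = P.pairingIn ℤ j i := by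
  apply FaithfulSMul.algebraMap_injective ℤ R
  rw [algebraMap_pairingIn, algebraMap_pairingIn]
  simp

lemma cocoeff_reflectionPerm (i j : ι) (k : b.support) :
    b.cocoeff (P.reflectionPerm j i) k = b.cocoeff i k - P.pairingIn ℤ j i * b.cocoeff j k := by
  rw [← pairingIn_flip]
  exact b.flip.coeff_reflectionPerm i j k

variable [Finite ι] [P.IsRootSystem]

/-- Coroots are rescaled roots, so the coordinates of a root and of its coroot differ by ratios of
root lengths. -/
lemma rootLength_mul_cocoeff [Fintype ι] (i : ι) (k : b.support) :
    (P.posRootForm ℤ).rootLength i * b.cocoeff i k =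
      b.coeff i k * (P.posRootForm ℤ).rootLength k := by
  set B := P.posRootForm ℤ
  have hN : B.rootLength i • P.coroot i =
      ∑ k : b.support, (b.coeff i k * B.rootLength k) • P.coroot k := by
    rw [← sub_eq_zero]
    refine (P.flip.eq_zero_iff_forall_coroot'_eq_zero).mpr fun j ↦ ?_
    change P.toLinearMap (P.root j) _ = 0
    rw [map_sub, map_sum, sub_eq_zero]
    simp only [map_zsmul, root_coroot_eq_pairing, zsmul_eq_mul, Int.cast_mul]
    have key : ∀ i, (B.rootLength i : R) * P.pairing j i = 2 * B.form (P.root j) (P.root i) := by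
      intro i
      rw [B.two_mul_apply_root_root, ← B.algebraMap_rootLength, mul_comm]
      rfl
    rw [key, ← b.sum_coeff_smul_root i]
    simp only [map_sum, map_zsmul, Finset.mul_sum, zsmul_eq_mul]
    refine Finset.sum_congr rfl fun k _ ↦ ?_
    rw [mul_assoc, key]
    ring
  have hli : LinearIndependent ℤ (fun k : b.support ↦ P.coroot k) :=
    b.linearIndepOn_coroot.restrict_scalars' ℤ
  refine Fintype.linearIndependent_iffₛ.mp hli (fun k ↦ B.rootLength i * b.cocoeff i k)
    (fun k ↦ b.coeff i k * B.rootLength k) ?_ k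
  rw [← hN]
  simp only [mul_smul, ← Finset.smul_sum]
  congr 1
  exact b.flip.sum_coeff_smul_root i

lemma cocoeff_pos_iff (i : ι) (k : b.support) : 0 < b.cocoeff i k ↔ 0 < b.coeff i k := by
  have := Fintype.ofFinite ι
  have h := b.rootLength_mul_cocoeff i k
  rw [← mul_pos_iff_of_pos_left ((P.posRootForm ℤ).rootLength_pos i), h,
    mul_pos_iff_of_pos_right ((P.posRootForm ℤ).rootLength_pos k)]

lemma cocoeff_nonneg_iff (i : ι) (k : b.support) : 0 ≤ b.cocoeff i k ↔ 0 ≤ b.coeff i k := by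
  have := Fintype.ofFinite ι
  have h := b.rootLength_mul_cocoeff i k
  rw [← mul_nonneg_iff_of_pos_left ((P.posRootForm ℤ).rootLength_pos i), h,
    mul_nonneg_iff_of_pos_right ((P.posRootForm ℤ).rootLength_pos k)]

lemma isPos_flip_iff (i : ι) : b.flip.IsPos i ↔ b.IsPos i := by
  rw [isPos_iff_coeff, isPos_iff_coeff]
  exact forall_congr' fun k ↦ b.cocoeff_nonneg_iff i k

variable {b}

/-- Passing from coroots to roots preserves inequalities with a longer larger side. -/
lemma rootLE_of_flip_rootLE [Fintype ι] {i j : ι} (hi : b.IsPos i)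
    (hl : (P.posRootForm ℤ).rootLength i ≤ (P.posRootForm ℤ).rootLength j)
    (h : b.flip.RootLE i j) : b.RootLE i j := by
  rw [rootLE_iff] at h ⊢
  intro k
  have h0 : 0 ≤ b.cocoeff i k := (b.cocoeff_nonneg_iff i k).mpr (b.isPos_iff_coeff.mp hi k)
  have h1 : b.cocoeff i k ≤ b.cocoeff j k := h k
  have hi' := b.rootLength_mul_cocoeff i k
  have hj' := b.rootLength_mul_cocoeff j k
  refine le_of_mul_le_mul_right ?_ ((P.posRootForm ℤ).rootLength_pos k)
  rw [← hi', ← hj']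
  exact mul_le_mul hl h1 h0 ((P.posRootForm ℤ).rootLength_pos j).le

/-- Passing from roots to coroots preserves inequalities with a shorter larger side. -/
lemma flip_rootLE_of_rootLE [Fintype ι] {i j : ι} (hi : b.IsPos i)
    (hl : (P.posRootForm ℤ).rootLength j ≤ (P.posRootForm ℤ).rootLength i)
    (h : b.RootLE i j) : b.flip.RootLE i j := by
  rw [rootLE_iff] at h ⊢
  intro k
  change b.cocoeff i k ≤ b.cocoeff j k
  have h0 : 0 ≤ b.coeff i k := b.isPos_iff_coeff.mp hi k
  have hi' := b.rootLength_mul_cocoeff i k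
  have hj' := b.rootLength_mul_cocoeff j k
  have pi := (P.posRootForm ℤ).rootLength_pos i
  have pj := (P.posRootForm ℤ).rootLength_pos j
  have pk := (P.posRootForm ℤ).rootLength_pos k
  refine le_of_mul_le_mul_left (a := (P.posRootForm ℤ).rootLength i *
    (P.posRootForm ℤ).rootLength j) ?_ (mul_pos pi pj)
  calc _ = b.coeff i k * (P.posRootForm ℤ).rootLength k * (P.posRootForm ℤ).rootLength j := by
        rw [← hi']; ring
    _ ≤ b.coeff j k * (P.posRootForm ℤ).rootLength k * (P.posRootForm ℤ).rootLength i :=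
        mul_le_mul (mul_le_mul_of_nonneg_right (h k) pk.le) hl pj.le
          (mul_nonneg (h0.trans (h k)) pk.le)
    _ = _ := by rw [← hj']; ring

lemma strongLE_of_simple {i : ι} (hi : b.IsPos i) {k : b.support} (hk : 0 < b.coeff i k) :
    b.StrongLE k i := by
  classical
  refine b.strongLE_iff.mpr ⟨fun l ↦ ?_, fun l ↦ ?_⟩
  · rw [coeff_simple]
    split_ifs with h
    · exact h ▸ hk
    · exact b.isPos_iff_coeff.mp hi l
  · have : b.cocoeff k l = if l = k then 1 else 0 := b.flip.coeff_simple k l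
    rw [this]
    split_ifs with h
    · exact h ▸ (b.cocoeff_pos_iff i k).mpr hk
    · exact (b.cocoeff_nonneg_iff i l).mpr (b.isPos_iff_coeff.mp hi l)

lemma cocoeff_nonpos_of_not_isPos {i : ι} (hi : ¬ b.IsPos i) (k : b.support) :
    b.cocoeff i k ≤ 0 := by
  rw [← isPos_flip_iff] at hi
  exact b.flip.not_isPos_iff_coeff.mp hi k

lemma strongLE_reflectionPerm_of_nonpos {i j : ι} (hj : b.IsPos j) (h : P.pairingIn ℤ i j ≤ 0) :
    b.StrongLE i (P.reflectionPerm j i) := by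
  have h' := (P.pairingIn_le_zero_iff ℤ).mp h
  refine b.strongLE_iff.mpr ⟨fun k ↦ ?_, fun k ↦ ?_⟩
  · have := mul_nonpos_of_nonpos_of_nonneg h (b.isPos_iff_coeff.mp hj k)
    rw [coeff_reflectionPerm]
    linarith
  · have := mul_nonpos_of_nonpos_of_nonneg h'
      ((b.cocoeff_nonneg_iff j k).mpr (b.isPos_iff_coeff.mp hj k))
    rw [cocoeff_reflectionPerm]
    linarith

lemma strongLE_reflectionPerm_of_nonneg {i j : ι} (hj : ¬ b.IsPos j) (h : 0 ≤ P.pairingIn ℤ i j) :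
    b.StrongLE i (P.reflectionPerm j i) := by
  have h' : 0 ≤ P.pairingIn ℤ j i := by
    by_contra! h'
    exact absurd h (not_le.mpr ((P.pairingIn_lt_zero_iff ℤ).mp h'))
  refine b.strongLE_iff.mpr ⟨fun k ↦ ?_, fun k ↦ ?_⟩
  · have := mul_nonpos_of_nonneg_of_nonpos h (b.not_isPos_iff_coeff.mp hj k)
    rw [coeff_reflectionPerm]
    linarith
  · have := mul_nonpos_of_nonneg_of_nonpos h' (cocoeff_nonpos_of_not_isPos hj k)
    rw [cocoeff_reflectionPerm]
    linarith

lemma reflectionPerm_strongLE {i j : ι} (hj : b.IsPos j) (h : 0 ≤ P.pairingIn ℤ i j) :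
    b.StrongLE (P.reflectionPerm j i) i := by
  have := strongLE_reflectionPerm_of_nonpos (i := P.reflectionPerm j i) hj (by
    rw [pairingIn_reflectionPerm_left]
    linarith)
  simpa using this

/-- Since `j - i` pairs with `a` at most to `2` times its coefficient at `a`, that coefficient is positive
as soon as the pairing of `j - i` with `a` is. -/
lemma rootLE_reflectionPerm_of_le_one {i j : ι} {a : b.support} (h : b.RootLE i j)
    (hi : P.pairingIn ℤ i a ≤ 0) (hj : 0 ≤ P.pairingIn ℤ j a) (hj' : P.pairingIn ℤ j a ≤ 1) :
    b.RootLE i (P.reflectionPerm a j) := by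
  classical
  rw [rootLE_iff] at h ⊢
  intro k
  rw [coeff_reflectionPerm, coeff_simple]
  split_ifs with hk
  · subst hk
    have h1 : P.pairingIn ℤ j k - P.pairingIn ℤ i k ≤ (b.coeff j k - b.coeff i k) * 2 := by
      rw [b.pairingIn_eq_sum j, b.pairingIn_eq_sum i, ← Finset.sum_sub_distrib,
        ← Finset.add_sum_erase _ _ (Finset.mem_univ k), pairingIn_same]
      have : ∑ l ∈ Finset.univ.erase k, (b.coeff j l * P.pairingIn ℤ l k -
          b.coeff i l * P.pairingIn ℤ l k) ≤ 0 := by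
        refine Finset.sum_nonpos fun l hl ↦ ?_
        have hlk : (l : ι) ≠ k := fun e ↦ Finset.ne_of_mem_erase hl (Subtype.ext e)
        have := mul_nonpos_of_nonneg_of_nonpos (sub_nonneg.mpr (h l))
          (b.pairingIn_le_zero_of_ne hlk l.2 k.2)
        linarith
      linarith
    have := h k
    lia
  · simpa using h k

variable [P.IsReduced] [P.IsIrreducible]

/-- An irreducible reduced root system has at most two root lengths. -/
lemma rootLength_le_of_pairingIn_gt_one [Fintype ι] {i j : ι} (h : 1 < P.pairingIn ℤ i j)
    (h' : P.pairingIn ℤ j i = 1) (k : ι) :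
    (P.posRootForm ℤ).rootLength j ≤ (P.posRootForm ℤ).rootLength k ∧
      (P.posRootForm ℤ).rootLength k ≤ (P.posRootForm ℤ).rootLength i := by
  set B := P.posRootForm ℤ
  have hs := B.pairingIn_mul_eq_pairingIn_mul_swap i j
  rw [h', one_mul] at hs
  have hj := B.rootLength_pos j
  have hlt : B.rootLength j < B.rootLength i := by nlinarith
  have hne : B.toInvariantForm.form (P.root i) (P.root i) ≠
      B.toInvariantForm.form (P.root j) (P.root j) := by
    change B.form (P.root i) (P.root i) ≠ B.form (P.root j) (P.root j)
    rw [← B.algebraMap_rootLength, ← B.algebraMap_rootLength]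
    exact fun e ↦ hlt.ne' (FaithfulSMul.algebraMap_injective ℤ R e)
  have hk := B.toInvariantForm.apply_eq_or_of_apply_ne hne k
  change B.form (P.root k) (P.root k) = B.form (P.root i) (P.root i) ∨
    B.form (P.root k) (P.root k) = B.form (P.root j) (P.root j) at hk
  simp only [← B.algebraMap_rootLength,
    (FaithfulSMul.algebraMap_injective ℤ R).eq_iff] at hk
  rcases hk with hk | hk <;> rw [hk] <;> constructor <;> lia

lemma rootLength_reflectionPerm [Fintype ι] (i j : ι) :
    (P.posRootForm ℤ).rootLength (P.reflectionPerm j i) = (P.posRootForm ℤ).rootLength i := by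
  apply FaithfulSMul.algebraMap_injective ℤ R
  simp only [RootPositiveForm.algebraMap_rootLength, root_reflectionPerm]
  exact (P.posRootForm ℤ).isOrthogonal_reflection j _ _

/-- If `i ≤ j`, where `i` pairs non-positively and `j` non-negatively with the simple root `a`, then
`i ≤ s_a j`. This fails for the usual order on roots in the doubly and triply laced cases: there the
pairing of `j` and `a` may be `2` or `3` for roots (or for coroots), but then it is `1` for coroots
(or for roots) and the inequality transfers because `j` is long (or short). -/
lemma StrongLE.reflectionPerm_right {i j : ι} {a : b.support} (h : b.StrongLE i j)
    (hi₀ : b.IsPos i) (hj₀ : b.IsPos j) (hja : j ≠ a)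
    (hi : P.pairingIn ℤ i a ≤ 0) (hj : 0 ≤ P.pairingIn ℤ j a) :
    b.StrongLE i (P.reflectionPerm a j) := by
  have := Fintype.ofFinite ι
  have hja' : P.root j ≠ -P.root a := by
    intro e
    have e' : j = P.reflectionPerm a a := P.root.injective (by simpa using e)
    rw [e', isPos_reflectionPerm_self_iff] at hj₀
    exact hj₀ (b.isPos_simple a)
  have hset := P.pairingIn_pairingIn_mem_set_of_isCrystal_of_isRed' j a
    (fun e ↦ hja (P.root.injective e)) hja'
  have hi' : P.flip.pairingIn ℤ i a ≤ 0 := by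
    rw [pairingIn_flip]; exact (P.pairingIn_le_zero_iff ℤ).mp hi
  have hroot : P.pairingIn ℤ j a ≤ 1 → b.RootLE i (P.reflectionPerm a j) :=
    rootLE_reflectionPerm_of_le_one h.1 hi hj
  have hcoroot : 0 ≤ P.pairingIn ℤ a j → P.pairingIn ℤ a j ≤ 1 →
      b.flip.RootLE i (P.reflectionPerm a j) := by
    intro h0 h1
    rw [← pairingIn_flip] at h0 h1
    exact rootLE_reflectionPerm_of_le_one (b := b.flip) (a := a) h.2 hi' h0 h1
  have hlong : 1 < P.pairingIn ℤ j a → P.pairingIn ℤ a j = 1 →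
      b.StrongLE i (P.reflectionPerm a j) := by
    intro h1 h2
    have h3 := hcoroot (by lia) (by lia)
    refine ⟨rootLE_of_flip_rootLE hi₀ ?_ h3, h3⟩
    rw [rootLength_reflectionPerm]
    exact (rootLength_le_of_pairingIn_gt_one h1 h2 i).2
  have hshort : 1 < P.pairingIn ℤ a j → P.pairingIn ℤ j a = 1 →
      b.StrongLE i (P.reflectionPerm a j) := by
    intro h1 h2
    have h3 := hroot (by lia)
    refine ⟨h3, flip_rootLE_of_rootLE hi₀ ?_ h3⟩
    rw [rootLength_reflectionPerm]
    exact (rootLength_le_of_pairingIn_gt_one h1 h2 i).1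
  simp only [Set.mem_insert_iff, Set.mem_singleton_iff, Prod.mk.injEq] at hset
  by_cases h1 : 1 < P.pairingIn ℤ j a
  · exact hlong h1 (by omega)
  by_cases h2 : 1 < P.pairingIn ℤ a j
  · exact hshort h2 (by omega)
  exact ⟨hroot (by omega), hcoroot (by omega) (by omega)⟩

/-! ### Removing a simple reflection -/

omit [P.IsCrystallographic] [Finite ι] [P.IsRootSystem] [P.IsReduced] [P.IsIrreducible] in
lemma mem_nuZero_iff {u : P.weylGroup} {i : ι} :
    i ∈ b.nuZero u ↔ b.IsPos i ∧ b.IsPos (u⁻¹ • i) := by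
  constructor
  · rintro ⟨⟨j, hj, rfl⟩, h⟩
    refine ⟨h, ?_⟩
    change b.IsPos (u⁻¹ • u • j)
    rwa [inv_smul_smul]
  · rintro ⟨h, h'⟩
    exact ⟨⟨u⁻¹ • i, h', smul_inv_smul u i⟩, h⟩

variable (b) in
/-- The variant of rationality in which roots and coroots are compared simultaneously. -/
def IsStronglyRational (u : P.weylGroup) : Prop :=
  ∀ α : b.nuZero u,
    ¬ Relation.TransGen (fun α β : b.nuZero u ↦ b.StrongLE (u⁻¹ • (α : ι)) β) α α

omit [P.IsCrystallographic] [Finite ι] [P.IsRootSystem] [P.IsReduced] [P.IsIrreducible] in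
lemma IsRational.isStronglyRational {u : P.weylGroup} (h : b.IsRational u) :
    b.IsStronglyRational u := fun α hα ↦
  h α (Relation.TransGen.mono (fun _ _ h' ↦ (h' : b.StrongLE _ _).1) _ _ hα)

/-- If the graph of `u` has no cycle, then neither has the graph of `s_a u`, for a simple root `a`
such that `u⁻¹ a > 0` and `u a < 0`. -/
lemma IsStronglyRational.simpleReflection_mul {u : P.weylGroup} (h : b.IsStronglyRational u)
    {a : b.support} (ha : b.IsPos (u⁻¹ • (a : ι))) (ha' : ¬ b.IsPos (u • (a : ι))) :
    b.IsStronglyRational (b.simpleReflection a * u) := by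
  classical
  have hinv (i : ι) : (b.simpleReflection a * u)⁻¹ • i = u⁻¹ • P.reflectionPerm a i := by
    rw [mul_inv_rev, mul_smul, inv_eq_of_mul_eq_one_left (b.simpleReflection_mul_self a)]
    rfl
  have hrefl (i : ι) : P.reflectionPerm a (P.reflectionPerm a i) = i := by simp
  -- the roots `β = s_a β'` and `x = u⁻¹ β` attached to a vertex `β'` of the graph of `s_a u`
  have hx (β : b.nuZero (b.simpleReflection a * u)) :
      b.IsPos (u⁻¹ • P.reflectionPerm a β) := by
    have := (mem_nuZero_iff.mp β.2).2
    rwa [hinv] at this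
  have hne (β : b.nuZero (b.simpleReflection a * u)) : (β : ι) ≠ a := by
    intro e
    have := hx β
    rw [e, smul_reflectionPerm, isPos_reflectionPerm_self_iff] at this
    exact this ha
  have hβ (β : b.nuZero (b.simpleReflection a * u)) : b.IsPos (P.reflectionPerm a β) :=
    b.isPos_simpleReflection_smul (mem_nuZero_iff.mp β.2).1 (hne β)
  have hxne (β : b.nuZero (b.simpleReflection a * u)) : u⁻¹ • P.reflectionPerm a β ≠ (a : ι) := by
    intro e
    refine ha' ?_
    rw [← e, smul_inv_smul]
    exact hβ β
  let y (β : b.nuZero (b.simpleReflection a * u)) : ι :=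
    if P.pairingIn ℤ (u⁻¹ • P.reflectionPerm a β) a ≤ 0 then u⁻¹ • P.reflectionPerm a β
    else P.reflectionPerm a (u⁻¹ • P.reflectionPerm a β)
  have hy (β) : b.IsPos (y β) := by
    simp only [y]
    split_ifs
    · exact hx β
    · exact b.isPos_simpleReflection_smul (hx β) (hxne β)
  have hya (β) : P.pairingIn ℤ (y β) a ≤ 0 := by
    simp only [y]
    split_ifs with hc
    · exact hc
    · rw [pairingIn_reflectionPerm_left]
      lia
  have hyx (β) : b.StrongLE (y β) (u⁻¹ • P.reflectionPerm a β) := by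
    simp only [y]
    split_ifs with hc
    · exact StrongLE.refl b _
    · exact reflectionPerm_strongLE (b.isPos_simple a) (not_le.mp hc).le
  have hg (β : b.nuZero (b.simpleReflection a * u)) : b.StrongLE (P.reflectionPerm a β) (u • y β) := by
    simp only [y]
    split_ifs with hc
    · rw [smul_inv_smul]
      exact StrongLE.refl b _
    · rw [smul_reflectionPerm, smul_inv_smul]
      refine strongLE_reflectionPerm_of_nonneg ha' ?_
      rw [← pairingIn_smul_smul u⁻¹, inv_smul_smul]
      exact (not_le.mp hc).le
  have hmem (β) : u • y β ∈ b.nuZero u := by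
    refine mem_nuZero_iff.mpr ⟨b.isPos_iff_coeff.mpr fun k ↦ ?_, by rw [inv_smul_smul]; exact hy β⟩
    exact (b.isPos_iff_coeff.mp (hβ β) k).trans ((b.strongLE_iff.mp (hg β)).1 k)
  intro α hα
  refine h ⟨_, hmem α⟩ (Relation.TransGen.lift (fun β ↦ (⟨u • y β, hmem β⟩ : b.nuZero u))
    (fun β γ hβγ ↦ ?_) _ _ hα)
  change b.StrongLE (u⁻¹ • u • y β) (u • y γ)
  rw [inv_smul_smul]
  rw [hinv] at hβγ
  have h1 : b.StrongLE (y β) γ := (hyx β).trans hβγ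
  refine StrongLE.trans ?_ (hg γ)
  by_cases hc : 0 ≤ P.pairingIn ℤ (γ : ι) a
  · exact h1.reflectionPerm_right (hy β) (mem_nuZero_iff.mp γ.2).1 (hne γ) (hya β) hc
  · exact h1.trans (strongLE_reflectionPerm_of_nonpos (b.isPos_simple a) (not_le.mp hc).le)

omit [P.IsIrreducible] in
/-- A minimal vertex of the graph of `u ≠ w₀` involves a simple root to which the removal lemma
applies. -/
lemma IsStronglyRational.exists_simple {w₀ : P.weylGroup} (hw₀ : b.IsLongest w₀) {u : P.weylGroup}
    (h : b.IsStronglyRational u) (hu : u ≠ w₀) :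
    ∃ a : b.support, b.IsPos (u⁻¹ • (a : ι)) ∧ ¬ b.IsPos (u • (a : ι)) := by
  obtain ⟨i, hi⟩ : ∃ i : b.support, b.IsPos (u⁻¹ • (i : ι)) := by
    by_contra! h'
    exact hu (hw₀.eq_of_forall_simple h')
  let r : b.nuZero u → b.nuZero u → Prop :=
    Relation.TransGen (fun α β : b.nuZero u ↦ b.StrongLE (u⁻¹ • (α : ι)) β)
  have : Std.Irrefl r := ⟨h⟩
  have hwf := Finite.wellFounded_of_trans_of_irrefl r
  obtain ⟨γ, -, hγ⟩ := hwf.has_min Set.univ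
    ⟨⟨i, mem_nuZero_iff.mpr ⟨b.isPos_simple i, hi⟩⟩, trivial⟩
  obtain ⟨hγ1, hγ2⟩ := mem_nuZero_iff.mp γ.2
  obtain ⟨k, hk, hk'⟩ := (hγ1.exists_simple_smul u⁻¹).1 hγ2
  refine ⟨k, hk', fun hpos ↦ ?_⟩
  have hm : u • (k : ι) ∈ b.nuZero u :=
    mem_nuZero_iff.mpr ⟨hpos, by rw [inv_smul_smul]; exact b.isPos_simple k⟩
  refine hγ ⟨_, hm⟩ trivial (Relation.TransGen.single ?_)
  change b.StrongLE (u⁻¹ • u • (k : ι)) γ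
  rw [inv_smul_smul]
  exact strongLE_of_simple hγ1 hk

end RootPairing.Base

namespace RootPairing.Base

variable {ι R M N : Type*} [Field R]
  [AddCommGroup M] [Module R M] [AddCommGroup N] [Module R N]
  {P : RootPairing ι R M N} (b : P.Base)

/-! ### The opposition involution -/

lemma ofIdx_smul_eq (i j : ι) : weylGroup.ofIdx P i • j = P.reflectionPerm i j := rfl

lemma reflectionPerm_neg_left (i j : ι) :
    P.reflectionPerm (P.reflectionPerm i i) j = P.reflectionPerm i j := by
  have h := smul_reflectionPerm (weylGroup.ofIdx P i) i (P.reflectionPerm i j)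
  simpa [ofIdx_smul_eq] using h.symm

/-- The map `i ↦ -w i` on roots; for the longest element it is the opposition involution. -/
noncomputable def opposition (w : P.weylGroup) (i : ι) : ι := P.reflectionPerm (w • i) (w • i)

lemma root_opposition (w : P.weylGroup) (i : ι) : P.root (opposition w i) = -(w • P.root i) := by
  rw [opposition, root_reflectionPerm, reflection_apply_self, root_smul]

lemma opposition_eq_smul (w : P.weylGroup) (i : ι) :
    opposition w i = w • P.reflectionPerm i i := by
  rw [smul_reflectionPerm, opposition]

lemma opposition_smul (w u : P.weylGroup) (i : ι) :
    opposition w (u • i) = (w * u * w⁻¹) • opposition w i := by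
  simp only [opposition_eq_smul, ← smul_reflectionPerm, mul_smul, inv_smul_smul]

lemma ofIdx_neg [P.IsRootSystem] (i : ι) :
    weylGroup.ofIdx P (P.reflectionPerm i i) = weylGroup.ofIdx P i := by
  have := conj_ofIdx (P := P) (weylGroup.ofIdx P i) i
  change _ = weylGroup.ofIdx P (P.reflectionPerm i i) at this
  rw [← this]
  simp

lemma conj_ofIdx_opposition [P.IsRootSystem] (w : P.weylGroup) (i : ι) :
    w * weylGroup.ofIdx P i * w⁻¹ = weylGroup.ofIdx P (opposition w i) := by
  rw [conj_ofIdx, opposition, ofIdx_neg]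

variable [CharZero R] [P.IsCrystallographic]

lemma pairingIn_opposition (w : P.weylGroup) (i j : ι) :
    P.pairingIn ℤ (opposition w i) (opposition w j) = P.pairingIn ℤ i j := by
  simp [opposition, pairingIn_smul_smul]

variable {b} {w₀ : P.weylGroup} [Finite ι] [P.IsReduced] [P.IsRootSystem]

namespace IsLongest

variable (hw₀ : b.IsLongest w₀)
include hw₀

lemma inv_eq : w₀⁻¹ = w₀ := inv_eq_of_mul_eq_one_left hw₀.mul_self

lemma isPos_opposition_iff (i : ι) : b.IsPos (opposition w₀ i) ↔ b.IsPos i := by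
  rw [opposition, isPos_reflectionPerm_self_iff, hw₀.isPos_smul_iff, not_not]

lemma opposition_opposition (i : ι) : opposition w₀ (opposition w₀ i) = i := by
  rw [opposition_eq_smul w₀ i, opposition_eq_smul, ← smul_reflectionPerm, smul_smul, hw₀.mul_self,
    one_smul, reflectionPerm_neg_left, P.reflectionPerm_self]

lemma opposition_mem_support (i : b.support) : opposition w₀ (i : ι) ∈ b.support := by
  have hpos : b.IsPos (opposition w₀ i) := (hw₀.isPos_opposition_iff i).mpr (b.isPos_simple i)
  obtain ⟨j, hj, hj'⟩ := hpos.exists_mem_support_pos_pairingIn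
  rw [P.zero_lt_pairingIn_iff'] at hj'
  by_contra hne
  have hij : opposition w₀ (i : ι) ≠ j := fun e ↦ hne (e ▸ hj)
  obtain ⟨k, hk⟩ := P.root_sub_root_mem_of_pairingIn_pos hj' hij
  have hkpos : b.IsPos k := hpos.sub hj hk
  -- apply the involution to the decomposition of the image of `i` as `k + j`
  have hi : P.root i = P.root (opposition w₀ k) + P.root (opposition w₀ j) := by
    have h := root_opposition w₀ (opposition w₀ (i : ι))
    rw [hw₀.opposition_opposition] at h
    rw [root_opposition w₀ k, root_opposition w₀ j, hk, smul_sub, h]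
    abel
  have h1 := b.height_add hi
  rw [height_one_of_mem_support i.2] at h1
  have h2 := b.isPos_iff.mp ((hw₀.isPos_opposition_iff k).mpr hkpos)
  have h3 := b.isPos_iff.mp ((hw₀.isPos_opposition_iff j).mpr (isPos_of_mem_support hj))
  lia

end IsLongest

/-- The permutation of the simple roots induced by `-w₀`. -/
noncomputable def simpleOpposition (hw₀ : b.IsLongest w₀) : Equiv.Perm b.support :=
  Function.Involutive.toPerm (fun i ↦ ⟨opposition w₀ i, hw₀.opposition_mem_support i⟩)
    fun i ↦ Subtype.ext (hw₀.opposition_opposition i)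

@[simp]
lemma coe_simpleOpposition (hw₀ : b.IsLongest w₀) (i : b.support) :
    (simpleOpposition hw₀ i : ι) = opposition w₀ i := rfl

@[simp]
lemma simpleOpposition_simpleOpposition (hw₀ : b.IsLongest w₀) (i : b.support) :
    simpleOpposition hw₀ (simpleOpposition hw₀ i) = i :=
  Subtype.ext (hw₀.opposition_opposition i)

lemma cartanMatrix_simpleOpposition (hw₀ : b.IsLongest w₀) (i j : b.support) :
    b.cartanMatrix (simpleOpposition hw₀ i) (simpleOpposition hw₀ j) = b.cartanMatrix i j :=
  pairingIn_opposition w₀ i j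

lemma conj_simpleReflection (hw₀ : b.IsLongest w₀) (i : b.support) :
    w₀ * b.simpleReflection i * w₀⁻¹ = b.simpleReflection (simpleOpposition hw₀ i) :=
  conj_ofIdx_opposition w₀ i

lemma coeff_opposition (hw₀ : b.IsLongest w₀) (i : ι) (k : b.support) :
    b.coeff (opposition w₀ i) k = b.coeff i (simpleOpposition hw₀ k) := by
  refine b.coeff_unique (f := fun k ↦ b.coeff i (simpleOpposition hw₀ k)) ?_ k
  rw [root_opposition, ← b.sum_coeff_smul_root i, Finset.smul_sum, ← Finset.sum_neg_distrib,
    ← Equiv.sum_comp (simpleOpposition hw₀)]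
  refine Finset.sum_congr rfl fun k _ ↦ ?_
  have h : w₀ • b.coeff i k • P.root k = b.coeff i k • w₀ • P.root k :=
    (DistribSMul.toAddMonoidHom M w₀).map_zsmul _ _
  rw [h, ← smul_neg, ← root_opposition, simpleOpposition_simpleOpposition, coe_simpleOpposition]

lemma rootLE_opposition_iff (hw₀ : b.IsLongest w₀) (i j : ι) :
    b.RootLE (opposition w₀ i) (opposition w₀ j) ↔ b.RootLE i j := by
  simp only [rootLE_iff, coeff_opposition hw₀]
  exact (simpleOpposition hw₀).forall_congr_right (q := fun k ↦ b.coeff i k ≤ b.coeff j k)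

lemma IsRational.conj (hw₀ : b.IsLongest w₀) {u : P.weylGroup} (h : b.IsRational u) :
    b.IsRational (w₀ * u * w₀⁻¹) := by
  have hconj (i : ι) : u⁻¹ • opposition w₀ i = opposition w₀ ((w₀ * u * w₀⁻¹)⁻¹ • i) := by
    rw [opposition_smul]
    simp only [mul_inv_rev, ← mul_assoc, hw₀.mul_self, hw₀.inv_eq]
    simp [mul_assoc, hw₀.mul_self]
  have hmem (α : b.nuZero (w₀ * u * w₀⁻¹)) : opposition w₀ (α : ι) ∈ b.nuZero u := by
    rw [mem_nuZero_iff, hconj, hw₀.isPos_opposition_iff, hw₀.isPos_opposition_iff]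
    exact mem_nuZero_iff.mp α.2
  intro α hα
  refine h ⟨_, hmem α⟩ (Relation.TransGen.lift
    (fun β : b.nuZero (w₀ * u * w₀⁻¹) ↦ (⟨opposition w₀ β, hmem β⟩ : b.nuZero u))
    (fun β γ hβγ ↦ ?_) _ _ hα)
  change b.RootLE (u⁻¹ • opposition w₀ (β : ι)) (opposition w₀ γ)
  rw [hconj, rootLE_opposition_iff hw₀]
  exact hβγ

lemma conj_conj (hw₀ : b.IsLongest w₀) (u : P.weylGroup) :
    w₀ * (w₀ * u * w₀⁻¹) * w₀⁻¹ = u := by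
  rw [hw₀.inv_eq]
  calc w₀ * (w₀ * u * w₀) * w₀ = (w₀ * w₀) * u * (w₀ * w₀) := by group
    _ = u := by rw [hw₀.mul_self]; simp

/-- The automorphism of the rationality graph induced by conjugation with `w₀`. -/
noncomputable def graphOpposition (hw₀ : b.IsLongest w₀) : b.rationalityGraph ≃g b.rationalityGraph where
  toFun u := ⟨w₀ * u * w₀⁻¹, u.2.conj hw₀⟩
  invFun u := ⟨w₀ * u * w₀⁻¹, u.2.conj hw₀⟩
  left_inv u := Subtype.ext (conj_conj hw₀ u)
  right_inv u := Subtype.ext (conj_conj hw₀ u)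
  map_rel_iff' := by
    have key : ∀ u v : {u : P.weylGroup // b.IsRational u}, b.rationalityGraph.Adj u v →
        b.rationalityGraph.Adj ⟨w₀ * u * w₀⁻¹, u.2.conj hw₀⟩ ⟨w₀ * v * w₀⁻¹, v.2.conj hw₀⟩ := by
      rintro u v ⟨i, hi⟩
      refine ⟨simpleOpposition hw₀ i, ?_⟩
      change w₀ * u * w₀⁻¹ = _ * (w₀ * v * w₀⁻¹)
      rw [← conj_simpleReflection hw₀, hi]
      group
    intro u v
    refine ⟨fun h ↦ ?_, key u v⟩
    have := key ⟨w₀ * u * w₀⁻¹, u.2.conj hw₀⟩ ⟨w₀ * v * w₀⁻¹, v.2.conj hw₀⟩ h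
    simpa only [conj_conj hw₀] using this

@[simp]
lemma coe_graphOpposition (hw₀ : b.IsLongest w₀) (u : {u : P.weylGroup // b.IsRational u}) :
    (graphOpposition hw₀ u : P.weylGroup) = w₀ * u * w₀⁻¹ := rfl

lemma nuZero_longest (hw₀ : b.IsLongest w₀) : b.nuZero w₀ = ∅ := by
  ext i
  simp only [mem_nuZero_iff, hw₀.inv_eq, hw₀.isPos_smul_iff, Set.mem_empty_iff_false]
  tauto

lemma isRational_longest (hw₀ : b.IsLongest w₀) : b.IsRational w₀ := fun α ↦ by
  have := α.2
  simp [nuZero_longest hw₀] at this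

/-! ### Fixed vertices of the opposition involution -/

omit [P.IsRootSystem] in
/-- The vertices of the graph of `s_a u` are mapped by `s_a` to vertices of the graph of `u` other
than `a`. -/
lemma ncard_nuZero_simpleReflection_mul_lt {u : P.weylGroup} {a : b.support}
    (ha : b.IsPos (u⁻¹ • (a : ι))) :
    (b.nuZero (b.simpleReflection a * u)).ncard < (b.nuZero u).ncard := by
  have hinv (i : ι) : (b.simpleReflection a * u)⁻¹ • i = u⁻¹ • P.reflectionPerm a i := by
    rw [mul_inv_rev, mul_smul, inv_eq_of_mul_eq_one_left (b.simpleReflection_mul_self a)]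
    rfl
  rw [← Set.ncard_image_of_injective _ (P.reflectionPerm a).injective]
  have hneg : P.reflectionPerm a a ∉ b.nuZero (b.simpleReflection a * u) := fun h ↦
    (b.isPos_reflectionPerm_self_iff (a : ι)).mp (mem_nuZero_iff.mp h).1 (b.isPos_simple a)
  have hane : (a : ι) ∉ b.nuZero (b.simpleReflection a * u) := fun h ↦ by
    have := (mem_nuZero_iff.mp h).2
    rw [hinv, smul_reflectionPerm, isPos_reflectionPerm_self_iff] at this
    exact this ha
  refine Set.ncard_lt_ncard ((Set.ssubset_iff_of_subset ?_).mpr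
    ⟨a, mem_nuZero_iff.mpr ⟨b.isPos_simple a, ha⟩, ?_⟩) (Set.toFinite _)
  · rintro - ⟨i, hi, rfl⟩
    have hi' := mem_nuZero_iff.mp hi
    rw [hinv] at hi'
    exact mem_nuZero_iff.mpr
      ⟨b.isPos_simpleReflection_smul hi'.1 fun e ↦ hane (e ▸ hi), hi'.2⟩
  · rintro ⟨i, hi, hia⟩
    refine hneg ?_
    have h := congrArg (P.reflectionPerm a) hia
    rw [P.reflectionPerm_self] at h
    rwa [← h]

end RootPairing.Base

namespace RootPairing.Base

variable {ι R M N : Type*} [Finite ι] [Field R] [CharZero R]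
  [AddCommGroup M] [Module R M] [AddCommGroup N] [Module R N]
  {P : RootPairing ι R M N} [P.IsCrystallographic] [P.IsReduced]
  {b : P.Base} {w₀ : P.weylGroup}

lemma simpleReflection_mul_inv_smul (a : b.support) (u : P.weylGroup) (i : ι) :
    (b.simpleReflection a * u)⁻¹ • i = u⁻¹ • b.simpleReflection a • i := by
  rw [mul_inv_rev, mul_smul, inv_eq_of_mul_eq_one_left (b.simpleReflection_mul_self a)]

/-- A negative root remains negative under a simple reflection, unless it is the negative of the
simple root. -/
lemma not_isPos_simpleReflection_smul_smul {u : P.weylGroup} {a : b.support} {c : ι}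
    (hc : b.IsPos c) (ha : b.IsPos (u⁻¹ • (a : ι))) (h : ¬ b.IsPos (u • c)) :
    ¬ b.IsPos (b.simpleReflection a • u • c) := by
  rwa [isPos_simpleReflection_smul_iff]
  · rintro e
    exact h (e ▸ b.isPos_simple a)
  · rintro e
    have : c = P.reflectionPerm (u⁻¹ • (a : ι)) (u⁻¹ • (a : ι)) := by
      rw [← smul_reflectionPerm, ← e, inv_smul_smul]
    rw [this, isPos_reflectionPerm_self_iff] at hc
    exact hc ha

lemma root_reflectionPerm_eq (i j : ι) :
    P.root (P.reflectionPerm i j) = P.root j - P.pairingIn ℤ j i • P.root i := by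
  rw [root_reflectionPerm, reflection_apply_root, ← Int.cast_smul_eq_zsmul R,
    ← P.algebraMap_pairingIn ℤ]
  rfl

lemma reflectionPerm_eq_self_of_pairingIn_eq_zero {i j : ι} (h : P.pairingIn ℤ j i = 0) :
    P.reflectionPerm i j = j :=
  P.root.injective (by rw [root_reflectionPerm_eq, h, zero_smul, sub_zero])

lemma root_reflectionPerm_of_pairingIn_eq_neg_one {i j : ι} (h : P.pairingIn ℤ j i = -1) :
    P.root (P.reflectionPerm i j) = P.root i + P.root j := by
  rw [root_reflectionPerm_eq, h, neg_one_smul, sub_neg_eq_add, add_comm]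

/-- Simple roots that pair symmetrically, such as those exchanged by a symmetry of the Cartan matrix,
span a system of type `A₁ × A₁` or `A₂`. -/
lemma cartanMatrix_eq_zero_or_of_eq_symm {i j : b.support} (hij : i ≠ j)
    (h : b.cartanMatrix i j = b.cartanMatrix j i) :
    b.cartanMatrix i j = 0 ∨ b.cartanMatrix i j = -1 := by
  have hle := b.cartanMatrix_le_zero_of_ne i j hij
  have := P.pairingIn_pairingIn_mem_set_of_isCrystal_of_isRed' (i : ι) j
    (P.root.injective.ne (Subtype.coe_injective.ne hij))
    (b.root_ne_neg_of_ne i.2 j.2 (Subtype.coe_injective.ne hij))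
  change (b.cartanMatrix i j, b.cartanMatrix j i) ∈ _ at this
  simp only [Set.mem_insert_iff, Set.mem_singleton_iff, Prod.mk.injEq] at this
  lia

variable [P.IsRootSystem] [P.IsIrreducible]

/-- The longest element is the only strongly rational element that commutes with it. -/
theorem IsStronglyRational.eq_longest_of_conj_eq (hw₀ : b.IsLongest w₀) {u : P.weylGroup}
    (h : b.IsStronglyRational u) (hu : w₀ * u * w₀⁻¹ = u) : u = w₀ := by
  induction hn : (b.nuZero u).ncard using Nat.strong_induction_on generalizing u with
  | _ n ih
  subst hn
  by_contra hne
  obtain ⟨a, ha, ha'⟩ := h.exists_simple hw₀ hne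
  set e := simpleOpposition hw₀ a with he
  have hea : opposition w₀ (a : ι) = e := rfl
  have hae : opposition w₀ (e : ι) = a := hw₀.opposition_opposition a
  have hopp (i : ι) : opposition w₀ (u • i) = u • opposition w₀ i := by
    rw [opposition_smul, hu]
  have hopp' (i : ι) : opposition w₀ (u⁻¹ • i) = u⁻¹ • opposition w₀ i := by
    rw [opposition_smul]
    congr 1
    nth_rewrite 2 [← hu]
    group
  have he1 : b.IsPos (u⁻¹ • (e : ι)) := by rwa [← hea, ← hopp', hw₀.isPos_opposition_iff]
  have he2 : ¬ b.IsPos (u • (e : ι)) := by rwa [← hea, ← hopp, hw₀.isPos_opposition_iff]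
  have hsa := conj_simpleReflection hw₀ a
  have hse := conj_simpleReflection hw₀ e
  rw [← he] at hsa
  rw [he, simpleOpposition_simpleOpposition, ← he] at hse
  have h1 := h.simpleReflection_mul ha ha'
  have n1 := ncard_nuZero_simpleReflection_mul_lt ha
  have hself (i : ι) (hi : b.IsPos i) (hii : u⁻¹ • i = i) : False := by
    have hm : i ∈ b.nuZero u := mem_nuZero_iff.mpr ⟨hi, hii.symm ▸ hi⟩
    refine h ⟨i, hm⟩ (Relation.TransGen.single ?_)
    change b.StrongLE (u⁻¹ • i) i
    rw [hii]
    exact StrongLE.refl b i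
  by_cases hcase : e = a
  · -- `s_a u` commutes with `w₀`, and the graph of `s_a w₀` has a loop at `a`
    rw [hcase] at hsa
    have hv : b.simpleReflection a * u = w₀ := by
      refine ih _ n1 h1 ?_ rfl
      calc _ = (w₀ * b.simpleReflection a * w₀⁻¹) * (w₀ * u * w₀⁻¹) := by group
        _ = _ := by rw [hsa, hu]
    refine hself a (b.isPos_simple a) ?_
    have := simpleReflection_mul_inv_smul a u (P.reflectionPerm (a : ι) a)
    rw [hv, simpleReflection_smul, P.reflectionPerm_self, hw₀.inv_eq,
      ← opposition_eq_smul, hea, hcase] at this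
    exact this.symm
  have hea1 : (e : ι) ≠ a := fun h' ↦ hcase (Subtype.ext h')
  have hsym : P.pairingIn ℤ (e : ι) a = P.pairingIn ℤ (a : ι) e := by
    rw [← pairingIn_opposition w₀, hae, hea]
  have hm1 : ¬ b.IsPos ((b.simpleReflection a * u) • (e : ι)) := by
    rw [mul_smul]
    exact not_isPos_simpleReflection_smul_smul (b.isPos_simple e) ha he2
  have n2 := ncard_nuZero_simpleReflection_mul_lt (u := b.simpleReflection a * u) (a := e)
  rw [simpleReflection_mul_inv_smul] at n2
  rcases cartanMatrix_eq_zero_or_of_eq_symm hcase hsym with hp | hp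
  · -- `s_e s_a u` commutes with `w₀`, and the graph of `s_a s_e w₀` contains `a → e → a`
    have hae0 : b.simpleReflection e • (a : ι) = a :=
      reflectionPerm_eq_self_of_pairingIn_eq_zero (hsym.symm.trans hp)
    have hea0 : b.simpleReflection a • (e : ι) = e :=
      reflectionPerm_eq_self_of_pairingIn_eq_zero hp
    have hcom : b.simpleReflection a * b.simpleReflection e =
        b.simpleReflection e * b.simpleReflection a := by
      rw [← mul_inv_eq_iff_eq_mul]
      exact (conj_ofIdx _ _).trans (congrArg _ hea0)
    have hpos : b.IsPos ((b.simpleReflection a * u)⁻¹ • (e : ι)) := by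
      rwa [simpleReflection_mul_inv_smul, hea0]
    have hv : b.simpleReflection e * (b.simpleReflection a * u) = w₀ := by
      refine ih _ ((n2 (hea0.symm ▸ he1)).trans n1) (h1.simpleReflection_mul hpos hm1) ?_ rfl
      calc _ = (w₀ * b.simpleReflection e * w₀⁻¹) * (w₀ * b.simpleReflection a * w₀⁻¹) *
          (w₀ * u * w₀⁻¹) := by group
        _ = _ := by rw [hsa, hu, hse, hcom, mul_assoc]
    have h2 : (b.simpleReflection e * (b.simpleReflection a * u))⁻¹ • P.reflectionPerm (a : ι) a =
        e := by rw [hv, hw₀.inv_eq, ← opposition_eq_smul, hea]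
    rw [simpleReflection_mul_inv_smul, simpleReflection_mul_inv_smul,
      smul_reflectionPerm (b.simpleReflection e), hae0, simpleReflection_smul,
      P.reflectionPerm_self] at h2
    have h3 : u⁻¹ • (e : ι) = a := by rw [← hea, ← hopp', h2, hae]
    have hma : (a : ι) ∈ b.nuZero u := mem_nuZero_iff.mpr ⟨b.isPos_simple a, ha⟩
    have hme : (e : ι) ∈ b.nuZero u := mem_nuZero_iff.mpr ⟨b.isPos_simple e, he1⟩
    refine h ⟨a, hma⟩ ((Relation.TransGen.single (b := ⟨e, hme⟩) ?_).tail ?_)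
    · change b.StrongLE (u⁻¹ • (a : ι)) e
      rw [h2]
      exact StrongLE.refl b e
    · change b.StrongLE (u⁻¹ • (e : ι)) a
      rw [h3]
      exact StrongLE.refl b a
  · -- `s_a s_e s_a u` commutes with `w₀`, and the graph of `s_a s_e s_a w₀` has a loop at `a + e`
    set η := b.simpleReflection a • (e : ι) with hη
    have hroot : P.root η = P.root a + P.root e := root_reflectionPerm_of_pairingIn_eq_neg_one hp
    have hη' : b.simpleReflection e • (a : ι) = η := P.root.injective <| by
      rw [hroot, add_comm]
      exact root_reflectionPerm_of_pairingIn_eq_neg_one (hsym.symm.trans hp)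
    have hηpos : b.IsPos η := (b.isPos_simple a).add (b.isPos_simple e) hroot
    have hηpos' : b.IsPos (u⁻¹ • η) := ha.add he1 (by simp only [root_smul, hroot, smul_add])
    have hoppη : opposition w₀ η = η := by
      rw [hη, opposition_smul, hsa, hae, hη']
    have hbraid : b.simpleReflection a * b.simpleReflection e * b.simpleReflection a =
        b.simpleReflection e * b.simpleReflection a * b.simpleReflection e := by
      have e1 := conj_ofIdx (b.simpleReflection a) (e : ι)
      have e2 := conj_ofIdx (b.simpleReflection e) (a : ι)
      rw [inv_eq_of_mul_eq_one_left (b.simpleReflection_mul_self _)] at e1 e2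
      exact e1.trans ((congrArg _ hη'.symm).trans e2.symm)
    have hsη : (b.simpleReflection a * b.simpleReflection e * b.simpleReflection a) • η =
        P.reflectionPerm η η := by
      have e1 := conj_ofIdx (b.simpleReflection a) (e : ι)
      rw [inv_eq_of_mul_eq_one_left (b.simpleReflection_mul_self _)] at e1
      exact congrArg (· • η) e1
    have hsa2 (x : ι) : b.simpleReflection a • b.simpleReflection a • x = x := by
      rw [smul_smul, b.simpleReflection_mul_self, one_smul]
    have hpos2 : b.IsPos ((b.simpleReflection a * u)⁻¹ • (e : ι)) := by
      rwa [simpleReflection_mul_inv_smul]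
    have h2 := h1.simpleReflection_mul hpos2 hm1
    have hpos3 : b.IsPos ((b.simpleReflection e * (b.simpleReflection a * u))⁻¹ • (a : ι)) := by
      rwa [simpleReflection_mul_inv_smul, simpleReflection_mul_inv_smul, hη', hη, hsa2]
    have hm2 : ¬ b.IsPos ((b.simpleReflection e * (b.simpleReflection a * u)) • (a : ι)) := by
      rw [mul_smul]
      refine not_isPos_simpleReflection_smul_smul (b.isPos_simple a) hpos2 ?_
      rw [mul_smul]
      exact not_isPos_simpleReflection_smul_smul (b.isPos_simple a) ha ha'
    have n3 := ncard_nuZero_simpleReflection_mul_lt hpos3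
    have hv : b.simpleReflection a * (b.simpleReflection e * (b.simpleReflection a * u)) = w₀ := by
      refine ih _ (n3.trans ((n2 hηpos').trans n1)) (h2.simpleReflection_mul hpos3 hm2) ?_ rfl
      calc _ = (w₀ * b.simpleReflection a * w₀⁻¹) * (w₀ * b.simpleReflection e * w₀⁻¹) *
          (w₀ * b.simpleReflection a * w₀⁻¹) * (w₀ * u * w₀⁻¹) := by group
        _ = _ := by rw [hsa, hu, hse, ← hbraid]; simp only [mul_assoc]
    refine hself η hηpos ?_
    have h3 : (b.simpleReflection a * (b.simpleReflection e * (b.simpleReflection a * u)))⁻¹ •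
        P.reflectionPerm η η = η := by rw [hv, hw₀.inv_eq, ← opposition_eq_smul, hoppη]
    rw [← hsη, ← mul_smul] at h3
    nth_rewrite 2 [← h3]
    congr 1
    group

end RootPairing.Base

namespace RootPairing.Base

variable {ι R M N : Type*} [Finite ι] [Field R] [CharZero R]
  [AddCommGroup M] [Module R M] [AddCommGroup N] [Module R N]
  {P : RootPairing ι R M N} [P.IsCrystallographic] [P.IsReduced]
  {b : P.Base} {w₀ : P.weylGroup} [P.IsRootSystem]

/-! ### When the longest element is not `-1` -/

lemma forall_smul_eq_neg_iff (hw₀ : b.IsLongest w₀) :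
    (∀ x : M, w₀ • x = -x) ↔ ∀ i : b.support, simpleOpposition hw₀ i = i := by
  constructor
  · refine fun h i ↦ Subtype.ext (P.root.injective ?_)
    rw [coe_simpleOpposition, root_opposition, h, neg_neg]
  · intro h
    have hx : ∀ x ∈ Submodule.span R (P.root '' b.support), w₀ • x = -x := by
      intro x hx
      induction hx using Submodule.span_induction with
      | mem x hx =>
        obtain ⟨i, hi, rfl⟩ := hx
        rw [← neg_neg (w₀ • P.root i), ← root_opposition, ← coe_simpleOpposition hw₀ ⟨i, hi⟩, h]
      | zero => simp
      | add x y _ _ hx hy => rw [smul_add, hx, hy, neg_add]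
      | smul r x _ hx => rw [smul_comm, hx, smul_neg]
    intro x
    refine hx x ?_
    rw [b.span_root_support]
    exact (IsRootSystem.span_root_eq_top (P := P)).ge Submodule.mem_top

/-- The only vertex of the graph of `s_a w₀` is `a`, and it has a loop only if `-w₀` fixes `a`. -/
lemma isRational_simpleReflection_mul_longest (hw₀ : b.IsLongest w₀) {a : b.support}
    (ha : simpleOpposition hw₀ a ≠ a) : b.IsRational (b.simpleReflection a * w₀) := by
  classical
  have hinv (i : ι) : (b.simpleReflection a * w₀)⁻¹ • i = w₀ • P.reflectionPerm a i := by
    rw [simpleReflection_mul_inv_smul, hw₀.inv_eq, simpleReflection_smul]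
  have hmem (α : b.nuZero (b.simpleReflection a * w₀)) : (α : ι) = a := by
    obtain ⟨h1, h2⟩ := mem_nuZero_iff.mp α.2
    rw [hinv, hw₀.isPos_smul_iff] at h2
    by_contra hne
    exact h2 (b.isPos_simpleReflection_smul h1 hne)
  intro α hα
  obtain ⟨γ, hγ, -⟩ := Relation.TransGen.head'_iff.mp hα
  change b.RootLE ((b.simpleReflection a * w₀)⁻¹ • (α : ι)) γ at hγ
  rw [hinv, hmem, hmem, ← opposition_eq_smul, ← coe_simpleOpposition hw₀, rootLE_iff] at hγ
  have := hγ (simpleOpposition hw₀ a)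
  rw [coeff_simple, coeff_simple, if_pos rfl, if_neg ha] at this
  lia

variable [P.IsIrreducible]

lemma IsRational.conj_eq_self_iff (hw₀ : b.IsLongest w₀) {u : P.weylGroup} (h : b.IsRational u) :
    w₀ * u * w₀⁻¹ = u ↔ u = w₀ := by
  refine ⟨h.isStronglyRational.eq_longest_of_conj_eq hw₀, ?_⟩
  rintro rfl
  simp

theorem nontrivial_isRational_iff (hw₀ : b.IsLongest w₀) :
    Nontrivial {u : P.weylGroup // b.IsRational u} ↔ ¬ ∀ x : M, w₀ • x = -x := by
  constructor
  · intro hnt h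
    refine not_subsingleton_iff_nontrivial.mpr hnt ⟨fun u v ↦ Subtype.ext ?_⟩
    have hconj (u : P.weylGroup) : w₀ * u * w₀⁻¹ = u := by
      refine b.weylGroup_ext fun i ↦ P.root.injective ?_
      rw [hw₀.inv_eq, root_smul, root_smul, mul_smul, mul_smul, h, h, smul_neg, neg_neg]
    rw [(u.2.conj_eq_self_iff hw₀).mp (hconj u), (v.2.conj_eq_self_iff hw₀).mp (hconj v)]
  · intro h
    rw [forall_smul_eq_neg_iff hw₀] at h
    push Not at h
    obtain ⟨a, ha⟩ := h
    refine ⟨⟨_, isRational_longest hw₀⟩, ⟨_, isRational_simpleReflection_mul_longest hw₀ ha⟩,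
      fun he ↦ b.simpleReflection_ne_one a ?_⟩
    exact mul_eq_right.mp (congrArg Subtype.val he).symm

/-! ### Connectedness -/

lemma rootLength_eq_of_cartanMatrix_symm [Fintype ι]
    (h : ∀ i j, b.cartanMatrix i j = b.cartanMatrix j i) (i j : ι) :
    (P.posRootForm ℤ).rootLength i = (P.posRootForm ℤ).rootLength j := by
  set B := P.posRootForm ℤ
  have : Nonempty ι := ⟨i⟩
  obtain ⟨s, hs⟩ := b.support_nonempty
  have hsimple (k : b.support) : B.rootLength k = B.rootLength s := by
    refine b.induction_on_cartanMatrix (fun k ↦ B.rootLength k = B.rootLength s) (i := ⟨s, hs⟩) rfl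
      fun i j hi hij ↦ ?_
    have hl : b.cartanMatrix j i * B.rootLength i = b.cartanMatrix i j * B.rootLength j :=
      B.pairingIn_mul_eq_pairingIn_mul_swap i j
    rw [h i j] at hl
    exact (mul_left_cancel₀ hij hl).symm.trans hi
  suffices ∀ i, B.rootLength i = B.rootLength s by rw [this i, this j]
  intro i
  refine b.induction_reflect i (p := fun i ↦ B.rootLength i = B.rootLength s) (fun i hi ↦ ?_)
    (fun i hi ↦ hsimple ⟨i, hi⟩) fun i j hi _ ↦ ?_
  · rwa [rootLength_reflectionPerm]
  · rwa [rootLength_reflectionPerm]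

lemma IsStronglyRational.isRational (h : ∀ i j, b.cartanMatrix i j = b.cartanMatrix j i)
    {u : P.weylGroup} (hu : b.IsStronglyRational u) : b.IsRational u := by
  have := Fintype.ofFinite ι
  refine fun α hα ↦ hu α (Relation.TransGen.mono (fun β γ hβγ ↦ ?_) _ _ hα)
  have hβ := (mem_nuZero_iff.mp β.2).2
  exact ⟨hβγ, b.flip_rootLE_of_rootLE hβ (rootLength_eq_of_cartanMatrix_symm h _ _).le hβγ⟩

lemma reachable_longest (h : ∀ i j, b.cartanMatrix i j = b.cartanMatrix j i)
    (hw₀ : b.IsLongest w₀) (u : {u : P.weylGroup // b.IsRational u}) :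
    b.rationalityGraph.Reachable u ⟨w₀, isRational_longest hw₀⟩ := by
  induction hn : (b.nuZero (u : P.weylGroup)).ncard using Nat.strong_induction_on
    generalizing u with
  | _ n ih
  subst hn
  by_cases hu : (u : P.weylGroup) = w₀
  · obtain ⟨u, h⟩ := u
    subst hu
    rfl
  obtain ⟨a, ha, ha'⟩ := u.2.isStronglyRational.exists_simple hw₀ hu
  have hadj : b.rationalityGraph.Adj u ⟨_, (u.2.isStronglyRational.simpleReflection_mul ha
      ha').isRational h⟩ := ⟨a, by rw [← mul_assoc, simpleReflection_mul_self, one_mul]⟩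
  exact hadj.reachable.trans (ih _ (ncard_nuZero_simpleReflection_mul_lt ha) _ rfl)

theorem rationalityGraph_connected (hw₀ : b.IsLongest w₀)
    (h : (¬ ∀ x : M, w₀ • x = -x) → ∀ i j, b.cartanMatrix i j = b.cartanMatrix j i) :
    b.rationalityGraph.Connected := by
  have : Nonempty {u : P.weylGroup // b.IsRational u} := ⟨⟨w₀, isRational_longest hw₀⟩⟩
  refine ⟨fun u v ↦ ?_⟩
  by_cases hneg : ∀ x : M, w₀ • x = -x
  · have := not_nontrivial_iff_subsingleton.mp
      (mt (nontrivial_isRational_iff hw₀).mp (not_not.mpr hneg))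
    rw [Subsingleton.elim u v]
  · exact (reachable_longest (h hneg) hw₀ u).trans (reachable_longest (h hneg) hw₀ v).symm

end RootPairing.Base

namespace RootPairing.Base

variable {ι R M N : Type*} [Finite ι] [Field R] [CharZero R]
  [AddCommGroup M] [Module R M] [AddCommGroup N] [Module R N]
  {P : RootPairing ι R M N} [P.IsCrystallographic] [P.IsReduced]
  {b : P.Base} {w₀ : P.weylGroup} [P.IsRootSystem]

/-! ### The opposition involution and congruences modulo the weights -/

variable (b) in
lemma simpleReflection_smul_sum [DecidableEq b.support] (g : b.support → ℤ) (i : b.support) :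
    b.simpleReflection i • ∑ j, g j • P.root j =
      ∑ j, (g j - (Pi.single i (∑ k, g k * b.cartanMatrix k i) : b.support → ℤ) j) • P.root j := by
  have h1 (j : b.support) : b.simpleReflection i • g j • P.root j =
      g j • P.root j - (g j * b.cartanMatrix j i) • P.root i := by
    have h : b.simpleReflection i • g j • P.root j = g j • b.simpleReflection i • P.root j :=
      (DistribSMul.toAddMonoidHom M (b.simpleReflection i)).map_zsmul _ _
    rw [h, ← root_smul, simpleReflection_smul, root_reflectionPerm_eq, smul_sub, mul_smul]
    rfl
  have h2 : ∑ j, (Pi.single i (∑ k, g k * b.cartanMatrix k i) : b.support → ℤ) j • P.root j =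
      (∑ k, g k * b.cartanMatrix k i) • P.root i := by
    rw [Finset.sum_eq_single i (fun j _ hj ↦ by simp [hj]) (by simp), Pi.single_eq_same]
  simp only [Finset.smul_sum, sub_smul, Finset.sum_sub_distrib, h1, h2, Finset.sum_smul]

/-- The Weyl group acts trivially on weights modulo the root lattice. Hence if `f / m` is a weight,
then `-w₀` maps `f` to `-f` modulo `m`. -/
lemma dvd_simpleOpposition_add (hw₀ : b.IsLongest w₀) (m : ℤ) (f : b.support → ℤ)
    (hf : ∀ i, m ∣ ∑ j, f j * b.cartanMatrix j i) (j : b.support) :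
    m ∣ f (simpleOpposition hw₀ j) + f j := by
  classical
  have key (l : List b.support) : ∃ g : b.support → ℤ,
      (l.map b.simpleReflection).prod • ∑ j, f j • P.root j =
        ∑ j, (f j + m * g j) • P.root j := by
    induction l with
    | nil => exact ⟨0, by simp⟩
    | cons i l ih =>
      obtain ⟨g, hg⟩ := ih
      obtain ⟨q, hq⟩ := hf i
      refine ⟨g - Pi.single i (q + ∑ k, g k * b.cartanMatrix k i), ?_⟩
      rw [List.map_cons, List.prod_cons, mul_smul, hg, simpleReflection_smul_sum]
      refine Finset.sum_congr rfl fun j _ ↦ ?_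
      congr 1
      simp only [add_mul, Finset.sum_add_distrib, hq, mul_assoc, ← Finset.mul_sum, ← mul_add]
      rcases eq_or_ne j i with rfl | hj
      · simp
        ring
      · simp [hj]
  obtain ⟨l, hl⟩ := b.exists_word w₀
  obtain ⟨g, hg⟩ := key l
  have hneg : w₀ • ∑ j, f j • P.root j =
      ∑ j, (-f (simpleOpposition hw₀ j)) • P.root (j : ι) := by
    rw [Finset.smul_sum, ← Equiv.sum_comp (simpleOpposition hw₀)]
    refine Finset.sum_congr rfl fun k _ ↦ ?_
    have h : w₀ • f (simpleOpposition hw₀ k) • P.root (simpleOpposition hw₀ k) =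
        f (simpleOpposition hw₀ k) • w₀ • P.root (simpleOpposition hw₀ k) :=
      (DistribSMul.toAddMonoidHom M w₀).map_zsmul _ _
    rw [h, neg_smul, ← smul_neg, coe_simpleOpposition, ← hw₀.opposition_opposition k,
      root_opposition w₀ (opposition w₀ (k : ι)), hw₀.opposition_opposition, neg_neg]
  rw [hl, hneg] at hg
  have hli : LinearIndependent ℤ (fun k : b.support ↦ P.root k) :=
    b.linearIndepOn_root.restrict_scalars' ℤ
  have := Fintype.linearIndependent_iffₛ.mp hli _ _ hg j
  exact ⟨-g j, by linear_combination -this⟩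

/-- Transport of `dvd_simpleOpposition_add` to a numbering of the simple roots. -/
lemma dvd_add_of_cartanMatrix_eq (hw₀ : b.IsLongest w₀) {r : ℕ} {C : Matrix (Fin r) (Fin r) ℤ}
    (e : b.support ≃ Fin r) (he : ∀ i j, b.cartanMatrix i j = C (e i) (e j)) (m : ℤ)
    (f : Fin r → ℤ) (hf : ∀ i, m ∣ ∑ j, f j * C j i) (j : Fin r) :
    m ∣ f (e (simpleOpposition hw₀ (e.symm j))) + f j := by
  have := dvd_simpleOpposition_add hw₀ m (f ∘ e) (fun i ↦ ?_) (e.symm j)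
  · simpa using this
  · rw [← e.symm.sum_comp]
    simpa [he] using hf (e i)

/-- If the opposition involution is trivial, the weights have denominators at most `2`. -/
lemma dvd_two_mul_of_forall_smul_eq_neg (hw₀ : b.IsLongest w₀) (h : ∀ x : M, w₀ • x = -x)
    {r : ℕ} {C : Matrix (Fin r) (Fin r) ℤ}
    (hC : b.HasCartanType C) (m : ℤ)
    (f : Fin r → ℤ) (hf : ∀ i, m ∣ ∑ j, f j * C j i) (j : Fin r) : m ∣ 2 * f j := by
  obtain ⟨e, he⟩ := hC
  have := dvd_add_of_cartanMatrix_eq hw₀ e he m f hf j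
  rw [(forall_smul_eq_neg_iff hw₀).mp h] at this
  simpa [two_mul] using this

lemma sum_ite_val_eq {r : ℕ} (F : ℕ → ℤ) (k : ℕ) :
    ∑ j : Fin r, (if (j : ℕ) = k then F j else 0) = if k < r then F k else 0 := by
  rw [Fin.sum_univ_eq_sum_range (fun j ↦ if j = k then F j else 0), Finset.sum_ite_eq']
  simp

lemma sum_mul_A {r : ℕ} (F : ℕ → ℤ) (i : Fin r) :
    ∑ j : Fin r, F j * CartanMatrix.A r j i = 2 * F i - (if 0 < (i : ℕ) then F (i - 1) else 0) -
      if (i : ℕ) + 1 < r then F (i + 1) else 0 := by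
  have h (j : Fin r) : F j * CartanMatrix.A r j i =
      (2 * (if (j : ℕ) = i then F j else 0) -
        (if (j : ℕ) = if 0 < (i : ℕ) then (i : ℕ) - 1 else r then F j else 0)) -
        if (j : ℕ) = i + 1 then F j else 0 := by
    have := j.2
    simp only [CartanMatrix.A, Matrix.of_apply, Fin.ext_iff]
    grind
  simp only [h, Finset.sum_sub_distrib, ← Finset.mul_sum, sum_ite_val_eq]
  grind

lemma sum_mul_D {r : ℕ} (hr : 4 ≤ r) (F : ℕ → ℤ) (i : Fin r) :
    ∑ j : Fin r, F j * CartanMatrix.D r j i = 2 * F i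
      - (if 0 < (i : ℕ) ∧ (i : ℕ) + 1 < r then F (i - 1) else 0)
      - (if (i : ℕ) + 2 < r then F (i + 1) else 0)
      - (if (i : ℕ) + 1 = r then F (r - 3) else 0)
      - (if (i : ℕ) + 3 = r then F (r - 1) else 0) := by
  have h (j : Fin r) : F j * CartanMatrix.D r j i =
      2 * (if (j : ℕ) = i then F j else 0) -
        (if (j : ℕ) = if 0 < (i : ℕ) ∧ (i : ℕ) + 1 < r then (i : ℕ) - 1 else r then F j else 0) -
        (if (j : ℕ) = if (i : ℕ) + 2 < r then (i : ℕ) + 1 else r then F j else 0) -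
        (if (j : ℕ) = if (i : ℕ) + 1 = r then r - 3 else r then F j else 0) -
        (if (j : ℕ) = if (i : ℕ) + 3 = r then r - 1 else r then F j else 0) := by
    obtain ⟨i, hi⟩ := i
    obtain ⟨j, hj⟩ := j
    simp only [CartanMatrix.D, Matrix.of_apply, Fin.ext_iff]
    generalize F j = c
    grind (splits := 20)
  simp only [h, Finset.sum_sub_distrib, ← Finset.mul_sum, sum_ite_val_eq]
  grind

lemma not_forall_smul_eq_neg_of_A (hw₀ : b.IsLongest w₀) {r : ℕ} (hr : 2 ≤ r)
    (hC : b.HasCartanType (CartanMatrix.A r)) : ¬ ∀ x : M, w₀ • x = -x := by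
  intro h
  -- `r + 1` times a fundamental weight, modulo `r + 1`
  have := dvd_two_mul_of_forall_smul_eq_neg hw₀ h hC (r + 1) (fun j ↦ (j : ℕ) + 1) (fun i ↦ ?_)
    ⟨0, by lia⟩
  · have := Int.le_of_dvd (by norm_num) this
    simp at this
    lia
  · have hi := i.2
    rw [sum_mul_A (fun j ↦ (j : ℤ) + 1)]
    split_ifs with h1 h2 h2
    · exact ⟨0, by push_cast [Nat.cast_sub (show 1 ≤ (i : ℕ) by lia)]; lia⟩
    · exact ⟨1, by push_cast [Nat.cast_sub (show 1 ≤ (i : ℕ) by lia)]; lia⟩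
    · exact ⟨0, by push_cast; lia⟩
    · lia

lemma not_forall_smul_eq_neg_of_D (hw₀ : b.IsLongest w₀) {r : ℕ} (hr : 4 ≤ r) (hr' : Odd r)
    (hC : b.HasCartanType (CartanMatrix.D r)) : ¬ ∀ x : M, w₀ • x = -x := by
  intro h
  -- four times a half-spin weight, reduced modulo `4`
  let F (j : ℕ) : ℤ := if j + 2 = r then 1 else if j + 1 = r then -1 else if Even j then 2 else 0
  have := dvd_two_mul_of_forall_smul_eq_neg hw₀ h hC 4 (fun j ↦ F j) (fun i ↦ ?_)
    ⟨r - 2, by lia⟩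
  · simp only [F] at this
    rw [if_pos (by lia)] at this
    lia
  · have hi := i.2
    rw [sum_mul_D hr F]
    simp only [F]
    grind

lemma not_forall_smul_eq_neg_of_E₆ (hw₀ : b.IsLongest w₀)
    (hC : b.HasCartanType CartanMatrix.E₆) : ¬ ∀ x : M, w₀ • x = -x := by
  intro h
  -- three times a minuscule weight, modulo `3`
  have := dvd_two_mul_of_forall_smul_eq_neg hw₀ h hC 3 ![1, 0, 2, 0, 1, 2] (by decide +kernel) 0
  revert this
  decide

end RootPairing.Base

namespace RootPairing.Base

variable {ι R M N : Type*} [Finite ι] [Field R] [CharZero R]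
  [AddCommGroup M] [Module R M] [AddCommGroup N] [Module R N]
  {P : RootPairing ι R M N} [P.IsCrystallographic] [P.IsReduced]
  {b : P.Base} {w₀ : P.weylGroup} [P.IsRootSystem]

/-! ### Excluding configurations of affine type -/

/-- Positive definiteness: a positive combination of positive roots cannot pair non-positively with
all of them. -/
lemma exists_sum_pairingIn_pos {σ : Type*} [Fintype σ] [Nonempty σ] {g : σ → ι}
    (hg : ∀ k, b.IsPos (g k)) {x : σ → ℤ} (hx : ∀ k, 0 < x k) :
    ∃ k, 0 < ∑ l, x l * P.pairingIn ℤ (g l) (g k) := by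
  have := Fintype.ofFinite ι
  by_contra! h
  set B := P.posRootForm ℤ
  set v : P.rootSpan ℤ := ∑ k, x k • P.rootSpanMem ℤ (g k) with hv
  have hne : v ≠ 0 := by
    intro h0
    obtain ⟨k₀⟩ := ‹Nonempty σ›
    obtain ⟨s, hs⟩ := (hg k₀).exists_coeff_pos
    have h1 : ∑ j, (∑ k, x k * b.coeff (g k) j) • P.root (j : ι) = 0 := by
      have := congrArg Subtype.val h0
      rw [hv, AddSubmonoidClass.coe_finsetSum] at this
      simp only [Finset.sum_smul, mul_smul]
      rw [Finset.sum_comm]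
      simp only [← Finset.smul_sum, sum_coeff_smul_root]
      simpa [rootSpanMem] using this
    have hli : LinearIndependent ℤ (fun k : b.support ↦ P.root k) :=
      b.linearIndepOn_root.restrict_scalars' ℤ
    have h2 := Fintype.linearIndependent_iff.mp hli _ h1 s
    have h3 : 0 < ∑ k, x k * b.coeff (g k) s :=
      Finset.sum_pos' (fun k _ ↦ mul_nonneg (hx k).le (b.isPos_iff_coeff.mp (hg k) s))
        ⟨k₀, Finset.mem_univ _, mul_pos (hx k₀) hs⟩
    lia
  have hpos : 0 < B.posForm v v := P.posRootForm_posForm_pos_of_ne_zero ℤ hne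
  have h2 (l k : σ) : 2 * B.posForm (P.rootSpanMem ℤ (g l)) (P.rootSpanMem ℤ (g k)) =
      P.pairingIn ℤ (g l) (g k) * B.rootLength (g k) := by
    apply FaithfulSMul.algebraMap_injective ℤ R
    rw [map_mul, map_mul, B.algebraMap_posForm, B.algebraMap_rootLength, P.algebraMap_pairingIn,
      map_ofNat]
    exact B.two_mul_apply_root_root (g l) (g k)
  have h3 : 2 * B.posForm v v =
      ∑ k, x k * ((∑ l, x l * P.pairingIn ℤ (g l) (g k)) * B.rootLength (g k)) := by
    have (k : σ) : 2 * B.posForm v (P.rootSpanMem ℤ (g k)) =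
        (∑ l, x l * P.pairingIn ℤ (g l) (g k)) * B.rootLength (g k) := by
      rw [hv, map_sum, LinearMap.sum_apply, Finset.mul_sum, Finset.sum_mul]
      refine Finset.sum_congr rfl fun l _ ↦ ?_
      rw [map_smul, LinearMap.smul_apply, smul_eq_mul, mul_left_comm, h2, mul_assoc]
    simp only [← this]
    nth_rewrite 2 [hv]
    rw [map_sum, Finset.mul_sum]
    refine Finset.sum_congr rfl fun k _ ↦ ?_
    rw [map_smul, smul_eq_mul, mul_left_comm]
  have h4 : ∑ k, x k * ((∑ l, x l * P.pairingIn ℤ (g l) (g k)) * B.rootLength (g k)) ≤ 0 :=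
    Finset.sum_nonpos fun k _ ↦ mul_nonpos_of_nonneg_of_nonpos (hx k).le
      (mul_nonpos_of_nonpos_of_nonneg (h k) (B.rootLength_pos _).le)
  lia

/-- Positive roots whose pairings are bounded by a generalised Cartan matrix of affine type do not
exist. -/
lemma false_of_pairingIn_le {n : ℕ} [NeZero n] (A : Matrix (Fin n) (Fin n) ℤ) (x : Fin n → ℤ)
    (hx : ∀ k, 0 < x k) (hA : ∀ k, ∑ l, x l * A l k ≤ 0) {g : Fin n → ι}
    (hg : ∀ k, b.IsPos (g k)) (h : ∀ l k, P.pairingIn ℤ (g l) (g k) ≤ A l k) : False := by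
  obtain ⟨k, hk⟩ := exists_sum_pairingIn_pos hg hx
  have : ∑ l, x l * P.pairingIn ℤ (g l) (g k) ≤ ∑ l, x l * A l k :=
    Finset.sum_le_sum fun l _ ↦ mul_le_mul_of_nonneg_left (h l k) (hx l).le
  have := hA k
  lia

/-- The version of `false_of_pairingIn_le` for the simply laced diagram with edges `E`. -/
lemma false_of_edges {n : ℕ} [NeZero n] (E : List (Fin n × Fin n)) (x : Fin n → ℤ)
    (hx : ∀ k, 0 < x k)
    (hA : ∀ k, ∑ l, x l * (if l = k then 2 else if (l, k) ∈ E ∨ (k, l) ∈ E then -1 else 0) ≤ 0)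
    {g : Fin n → ι} (hg : ∀ k, b.IsPos (g k))
    (h0 : ∀ l k, l < k → P.pairingIn ℤ (g l) (g k) ≤ 0)
    (h : ∀ e ∈ E, P.pairingIn ℤ (g e.1) (g e.2) < 0) : False := by
  refine false_of_pairingIn_le (Matrix.of fun l k ↦ if l = k then 2 else
    if (l, k) ∈ E ∨ (k, l) ∈ E then -1 else 0) x hx hA hg fun l k ↦ ?_
  rw [Matrix.of_apply]
  split_ifs with h1 h2
  · simp [h1]
  · rcases h2 with h2 | h2
    · have := h _ h2
      lia
    · have := (P.pairingIn_lt_zero_iff ℤ).mp (h _ h2)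
      lia
  · rcases lt_or_gt_of_ne h1 with h2 | h2
    · exact h0 l k h2
    · exact (P.pairingIn_le_zero_iff ℤ).mp (h0 k l h2)

/-- The version of `false_of_edges` for simple roots. -/
lemma false_of_injective_of_edges {n : ℕ} [NeZero n] (E : List (Fin n × Fin n)) (x : Fin n → ℤ)
    (hx : ∀ k, 0 < x k)
    (hA : ∀ k, ∑ l, x l * (if l = k then 2 else if (l, k) ∈ E ∨ (k, l) ∈ E then -1 else 0) ≤ 0)
    {v : Fin n → b.support} (hv : v.Injective)
    (h : ∀ e ∈ E, b.cartanMatrix (v e.1) (v e.2) < 0) : False :=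
  false_of_edges (b := b) E x hx hA (g := fun k ↦ v k) (fun _ ↦ b.isPos_simple _)
    (fun _ _ hlk ↦ b.cartanMatrix_le_zero_of_ne _ _ (hv.ne hlk.ne)) h

variable {γ : ι} (hγ : b.IsPos γ)
include hγ

/-- Excludes the configurations of type `D̃ₙ`, where `γ` stands for the path between the forks. -/
lemma false_of_four_neighbors {t₁ t₂ t₃ t₄ : b.support} (h : [t₁, t₂, t₃, t₄].Nodup)
    (h₁ : P.pairingIn ℤ γ t₁ < 0) (h₂ : P.pairingIn ℤ γ t₂ < 0) (h₃ : P.pairingIn ℤ γ t₃ < 0)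
    (h₄ : P.pairingIn ℤ γ t₄ < 0) : False := by
  simp only [List.nodup_cons, List.mem_cons, not_or, List.not_mem_nil, not_false_iff,
    and_true, List.nodup_nil] at h
  obtain ⟨⟨h12, h13, h14⟩, ⟨h23, h24⟩, h34⟩ := h
  have hle (i j : b.support) (hij : i ≠ j) : P.pairingIn ℤ i j ≤ 0 :=
    b.cartanMatrix_le_zero_of_ne i j hij
  refine false_of_edges (b := b) (g := ![γ, t₁, t₂, t₃, t₄])
    [(0, 1), (0, 2), (0, 3), (0, 4)] ![2, 1, 1, 1, 1] (by decide) (by decide) ?_ ?_ ?_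
  · simp [Fin.forall_fin_succ, hγ, isPos_simple]
  · simp [Fin.forall_fin_succ, *, le_of_lt]
  · simp [*]

/-- Excludes cycles, where `γ` stands for a cycle from which two adjacent roots are removed. -/
lemma false_of_triangle {t t' : b.support} (h : P.pairingIn ℤ γ t < 0)
    (h' : P.pairingIn ℤ γ t' < 0) (htt' : b.cartanMatrix t t' < 0) : False := by
  have htt'' : P.pairingIn ℤ t t' < 0 := htt'
  refine false_of_edges (b := b) (g := ![γ, t, t'])
    [(0, 1), (0, 2), (1, 2)] ![1, 1, 1] (by decide) (by decide) ?_ ?_ ?_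
  · simp [Fin.forall_fin_succ, hγ, isPos_simple]
  · simp [Fin.forall_fin_succ, *, le_of_lt]
  · simp [*]

/-- Excludes the configuration of type `Ã₁`; if `γ` stands for a path, this excludes cycles. -/
lemma false_of_pairingIn_le_neg_two {t : b.support} (h : P.pairingIn ℤ γ t ≤ -2)
    (h' : P.pairingIn ℤ t γ ≤ -2) : False := by
  refine false_of_pairingIn_le (b := b) !![2, -2; -2, 2] ![1, 1] (by decide) (by decide)
    (g := ![γ, t]) ?_ ?_
  · simp [Fin.forall_fin_succ, hγ, isPos_simple]
  · simp [Fin.forall_fin_succ, *]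

/-- Excludes the configurations of type `C̃ₙ` and its dual, where `γ` stands for the inner path. -/
lemma pairingIn_of_two_neighbors {t t' : b.support} (hne : t ≠ t') (h : P.pairingIn ℤ γ t < 0)
    (h' : P.pairingIn ℤ γ t' < 0) :
    (P.pairingIn ℤ γ t = -1 ∨ P.pairingIn ℤ γ t' = -1) ∧
      (P.pairingIn ℤ t γ = -1 ∨ P.pairingIn ℤ t' γ = -1) := by
  have hle (i j : b.support) (hij : i ≠ j) : P.pairingIn ℤ i j ≤ 0 :=
    b.cartanMatrix_le_zero_of_ne i j hij
  have g1 := (P.pairingIn_lt_zero_iff ℤ).mp h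
  have g2 := (P.pairingIn_lt_zero_iff ℤ).mp h'
  have h1 := hle _ _ hne
  have h2 := hle _ _ hne.symm
  constructor
  · by_contra! hc
    refine false_of_pairingIn_le (b := b) !![2, -2, -2; -1, 2, 0; -1, 0, 2] ![1, 1, 1] (by decide)
      (by decide) (g := ![γ, t, t']) ?_ ?_
    · simp [Fin.forall_fin_succ, hγ, isPos_simple]
    · simp [Fin.forall_fin_succ]
      omega
  · by_contra! hc
    refine false_of_pairingIn_le (b := b) !![2, -1, -1; -2, 2, 0; -2, 0, 2] ![2, 1, 1] (by decide)
      (by decide) (g := ![γ, t, t']) ?_ ?_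
    · simp [Fin.forall_fin_succ, hγ, isPos_simple]
    · simp [Fin.forall_fin_succ]
      omega

/-- Excludes the configurations of type `B̃ₙ` and its dual, where `γ` stands for the path between the
fork and the multiple bond. -/
lemma pairingIn_of_three_neighbors {a a' t : b.support} (h : [a, a', t].Nodup)
    (h₁ : P.pairingIn ℤ γ a < 0) (h₂ : P.pairingIn ℤ γ a' < 0) (h₃ : P.pairingIn ℤ γ t < 0) :
    P.pairingIn ℤ γ t = -1 ∧ P.pairingIn ℤ t γ = -1 := by
  simp only [List.nodup_cons, List.mem_cons, not_or, List.not_mem_nil, not_false_iff,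
    and_true, List.nodup_nil] at h
  obtain ⟨⟨h12, h13⟩, h23⟩ := h
  have hle (i j : b.support) (hij : i ≠ j) : P.pairingIn ℤ i j ≤ 0 ∧ P.pairingIn ℤ j i ≤ 0 :=
    ⟨b.cartanMatrix_le_zero_of_ne i j hij, b.cartanMatrix_le_zero_of_ne j i hij.symm⟩
  have g1 := (P.pairingIn_lt_zero_iff ℤ).mp h₁
  have g2 := (P.pairingIn_lt_zero_iff ℤ).mp h₂
  have g3 := (P.pairingIn_lt_zero_iff ℤ).mp h₃
  have k1 := hle _ _ h12
  have k2 := hle _ _ h13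
  have k3 := hle _ _ h23
  constructor
  · by_contra! hc
    refine false_of_pairingIn_le (b := b) !![2, -1, -1, -2; -1, 2, 0, 0; -1, 0, 2, 0; -1, 0, 0, 2]
      ![2, 1, 1, 2] (by decide) (by decide) (g := ![γ, a, a', t]) ?_ ?_
    · simp [Fin.forall_fin_succ, hγ, isPos_simple]
    · simp [Fin.forall_fin_succ]
      omega
  · by_contra! hc
    refine false_of_pairingIn_le (b := b) !![2, -1, -1, -1; -1, 2, 0, 0; -1, 0, 2, 0; -2, 0, 0, 2]
      ![2, 1, 1, 1] (by decide) (by decide) (g := ![γ, a, a', t]) ?_ ?_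
    · simp [Fin.forall_fin_succ, hγ, isPos_simple]
    · simp [Fin.forall_fin_succ]
      omega

end RootPairing.Base

namespace RootPairing.Base

variable {ι R M N : Type*} [Finite ι] [Field R] [CharZero R]
  [AddCommGroup M] [Module R M] [AddCommGroup N] [Module R N]
  {P : RootPairing ι R M N} [P.IsCrystallographic] [P.IsReduced]
  {b : P.Base} [P.IsRootSystem]

/-! ### Paths in the Dynkin diagram -/

lemma cartanMatrix_lt_zero {i j : b.support} (hij : i ≠ j) (h : b.cartanMatrix i j ≠ 0) :
    b.cartanMatrix i j < 0 ∧ b.cartanMatrix j i < 0 := by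
  have h1 := b.cartanMatrix_le_zero_of_ne i j hij
  have h2 := b.cartanMatrix_le_zero_of_ne j i hij.symm
  have h3 := mt b.cartanMatrix_apply_eq_zero_iff_symm.mp h
  omega

variable (b) in
/-- The first `n` terms of `f` are simple roots that form a diagram of type `A n`. -/
def IsPathA (f : ℕ → b.support) (n : ℕ) : Prop :=
  ∀ i j, i < n → j < n →
    b.cartanMatrix (f i) (f j) = if i = j then 2 else if i + 1 = j ∨ j + 1 = i then -1 else 0

namespace IsPathA

variable {f : ℕ → b.support} {n : ℕ} (h : b.IsPathA f n)
include h

lemma eq_of_eq {i j : ℕ} (hi : i < n) (hj : j < n) (hij : f i = f j) : i = j := by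
  have h1 := h i j hi hj
  rw [hij, cartanMatrix_apply_same] at h1
  split_ifs at h1 <;> omega

lemma le_card : n ≤ Nat.card b.support := by
  have : (fun i : Fin n ↦ f i).Injective := fun i j hij ↦ Fin.ext (h.eq_of_eq i.2 j.2 hij)
  simpa using Nat.card_le_card_of_injective _ this

/-- The sum of the roots along a path is a root, whose coroot is the sum of the coroots. -/
lemma exists_root_eq_sum {i j : ℕ} (hij : i ≤ j) (hj : j < n) :
    ∃ γ, b.IsPos γ ∧ P.root γ = ∑ l ∈ Finset.Icc i j, P.root (f l) ∧
      P.coroot γ = ∑ l ∈ Finset.Icc i j, P.coroot (f l) := by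
  induction j, hij using Nat.le_induction with
  | base => exact ⟨f i, b.isPos_simple _, by simp, by simp⟩
  | succ j hij ih =>
    obtain ⟨γ, hγ, hr, hc⟩ := ih (by omega)
    have hC : ∑ l ∈ Finset.Icc i j, b.cartanMatrix (f l) (f (j + 1)) = -1 ∧
        ∑ l ∈ Finset.Icc i j, b.cartanMatrix (f (j + 1)) (f l) = -1 := by
      constructor <;>
      · rw [Finset.sum_eq_single j]
        · rw [h _ _ (by omega) (by omega)]
          simp
        · intro l hl hlj
          rw [Finset.mem_Icc] at hl
          rw [h _ _ (by omega) (by omega), if_neg (by omega), if_neg (by omega)]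
        · simp [hij]
    have h1 : P.pairing γ (f (j + 1)) = -1 := by
      rw [← root_coroot_eq_pairing, hr, map_sum, LinearMap.sum_apply]
      simp only [root_coroot_eq_pairing, ← P.algebraMap_pairingIn ℤ, ← map_sum]
      rw [show ∑ l ∈ Finset.Icc i j, P.pairingIn ℤ (f l) (f (j + 1)) = -1 from hC.1]
      simp
    have h2 : P.pairing (f (j + 1)) γ = -1 := by
      rw [← root_coroot_eq_pairing, hc, map_sum]
      simp only [root_coroot_eq_pairing, ← P.algebraMap_pairingIn ℤ, ← map_sum]
      rw [show ∑ l ∈ Finset.Icc i j, P.pairingIn ℤ (f (j + 1)) (f l) = -1 from hC.2]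
      simp
    have h3 : P.root (P.reflectionPerm (f (j + 1)) γ) =
        ∑ l ∈ Finset.Icc i (j + 1), P.root (f l) := by
      rw [root_reflectionPerm, reflection_apply_root, h1, Finset.sum_Icc_succ_top (by omega), hr]
      simp
    refine ⟨P.reflectionPerm (f (j + 1)) γ, ?_, h3, ?_⟩
    · refine hγ.add (b.isPos_simple (f (j + 1))) ?_
      rw [h3, hr, Finset.sum_Icc_succ_top (by omega)]
    · rw [coroot_reflectionPerm, coreflection_apply_coroot, h2, Finset.sum_Icc_succ_top (by omega),
        hc]
      simp

/-- Contracting a part of a path to a single root. -/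
lemma exists_contraction {i j : ℕ} (hij : i ≤ j) (hj : j < n) :
    ∃ γ, b.IsPos γ ∧ ∀ x : b.support, (∀ l, i ≤ l → l ≤ j → f l ≠ x) →
      (∀ l, i ≤ l → l ≤ j → P.pairingIn ℤ γ x ≤ b.cartanMatrix (f l) x ∧
        P.pairingIn ℤ x γ ≤ b.cartanMatrix x (f l)) ∧
      (i < j → P.pairingIn ℤ γ x ≤ b.cartanMatrix (f i) x + b.cartanMatrix (f j) x ∧
        P.pairingIn ℤ x γ ≤ b.cartanMatrix x (f i) + b.cartanMatrix x (f j)) := by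
  obtain ⟨γ, hγ, hr, hc⟩ := h.exists_root_eq_sum hij hj
  refine ⟨γ, hγ, fun x hx ↦ ?_⟩
  have h1 : P.pairingIn ℤ γ x = ∑ l ∈ Finset.Icc i j, b.cartanMatrix (f l) x := by
    apply FaithfulSMul.algebraMap_injective ℤ R
    rw [P.algebraMap_pairingIn, ← root_coroot_eq_pairing, hr, map_sum, LinearMap.sum_apply, map_sum]
    exact Finset.sum_congr rfl fun l _ ↦ (P.algebraMap_pairingIn ℤ _ _).symm
  have h2 : P.pairingIn ℤ x γ = ∑ l ∈ Finset.Icc i j, b.cartanMatrix x (f l) := by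
    apply FaithfulSMul.algebraMap_injective ℤ R
    rw [P.algebraMap_pairingIn, ← root_coroot_eq_pairing, hc, map_sum, map_sum]
    exact Finset.sum_congr rfl fun l _ ↦ (P.algebraMap_pairingIn ℤ _ _).symm
  have key (F : ℕ → ℤ) (hF : ∀ l ∈ Finset.Icc i j, F l ≤ 0) (T : Finset ℕ)
      (hT : T ⊆ Finset.Icc i j) : ∑ l ∈ Finset.Icc i j, F l ≤ ∑ l ∈ T, F l :=
    neg_le_neg_iff.mp <| by
      simpa only [← Finset.sum_neg_distrib] using
        Finset.sum_le_sum_of_subset_of_nonneg (f := fun l ↦ -F l) hT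
          fun l hl _ ↦ neg_nonneg.mpr (hF l hl)
  have n1 : ∀ l ∈ Finset.Icc i j, b.cartanMatrix (f l) x ≤ 0 := fun l hl ↦ by
    rw [Finset.mem_Icc] at hl
    exact b.cartanMatrix_le_zero_of_ne _ _ (hx l hl.1 hl.2)
  have n2 : ∀ l ∈ Finset.Icc i j, b.cartanMatrix x (f l) ≤ 0 := fun l hl ↦ by
    rw [Finset.mem_Icc] at hl
    exact b.cartanMatrix_le_zero_of_ne _ _ (hx l hl.1 hl.2).symm
  rw [h1, h2]
  refine ⟨fun l hl hl' ↦ ?_, fun hij' ↦ ?_⟩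
  · have hT : {l} ⊆ Finset.Icc i j := by simp [hl, hl']
    simpa using And.intro (key _ n1 _ hT) (key _ n2 _ hT)
  · have hT : {i, j} ⊆ Finset.Icc i j := by
      intro l
      simp only [Finset.mem_insert, Finset.mem_singleton, Finset.mem_Icc]
      omega
    simpa [Finset.sum_pair hij'.ne] using And.intro (key _ n1 _ hT) (key _ n2 _ hT)

/-- A simple root outside a path has at most one neighbour on it. -/
lemma eq_of_adj {t : b.support} (ht : ∀ l < n, f l ≠ t) {i j : ℕ} (hi : i < n) (hj : j < n)
    (hti : b.cartanMatrix t (f i) ≠ 0) (htj : b.cartanMatrix t (f j) ≠ 0) : i = j := by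
  wlog hij : i < j generalizing i j
  · rcases (not_lt.mp hij).eq_or_lt with h' | h'
    · exact h'.symm
    · exact (this hj hi htj hti h').symm
  obtain ⟨γ, hγ, H⟩ := h.exists_contraction hij.le hj
  have := (H t fun l _ hl ↦ ht l (by omega)).2 hij
  have h1 := cartanMatrix_lt_zero (ht i hi).symm hti
  have h2 := cartanMatrix_lt_zero (ht j hj).symm htj
  exact (false_of_pairingIn_le_neg_two hγ (t := t) (by omega) (by omega)).elim

end IsPathA

/-! ### Symmetric paths -/

variable {ε : Equiv.Perm b.support}

variable (b ε) in
/-- A diagram of type `A n` on which the symmetry `ε` of the Dynkin diagram acts by reversal. -/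
def IsSymmPathA (f : ℕ → b.support) (n : ℕ) : Prop :=
  b.IsPathA f n ∧ ∀ i < n, ε (f i) = f (n - 1 - i)

namespace IsSymmPathA

variable {f : ℕ → b.support} {n : ℕ} (h : b.IsSymmPathA ε f n)
  (hε : ∀ i, ε (ε i) = i) (hεC : ∀ i j, b.cartanMatrix (ε i) (ε j) = b.cartanMatrix i j)
include h hε

lemma apply_ne {t : b.support} (ht : ∀ l < n, f l ≠ t) : ∀ l < n, f l ≠ ε t := by
  intro l hl he
  refine ht (n - 1 - l) (by omega) ?_
  rw [← h.2 l hl, he, hε]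

include hεC

omit hε in
lemma cartanMatrix_apply (t : b.support) {i : ℕ} (hi : i < n) :
    b.cartanMatrix (ε t) (f (n - 1 - i)) = b.cartanMatrix t (f i) ∧
      b.cartanMatrix (f (n - 1 - i)) (ε t) = b.cartanMatrix (f i) t := by
  rw [← h.2 i hi, hεC, hεC]
  exact ⟨rfl, rfl⟩

/-- Prolonging a symmetric path at both ends. -/
lemma exists_prolongation (hn : 2 ≤ n) {t : b.support} (ht : ∀ l < n, f l ≠ t) (htε : ε t ≠ t)
    (htt : b.cartanMatrix t (ε t) = 0) (h0 : b.cartanMatrix t (f 0) ≠ 0) :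
    ∃ g, b.IsSymmPathA ε g (n + 2) := by
  have ht' := h.apply_ne hε ht
  obtain ⟨γ, hγ, H⟩ := h.1.exists_contraction (Nat.zero_le (n - 1)) (by omega)
  have H1 := (H t fun l _ hl ↦ ht l (by omega)).1 0 le_rfl (by omega)
  have H2 := (H (ε t) fun l _ hl ↦ ht' l (by omega)).1 (n - 1) (by omega) le_rfl
  have hC := h.cartanMatrix_apply hεC t (i := 0) (by omega)
  rw [Nat.sub_zero] at hC
  have hlt := cartanMatrix_lt_zero (ht 0 (by omega)).symm h0
  have := pairingIn_of_two_neighbors hγ htε.symm (by omega) (by omega)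
  have e1 : b.cartanMatrix t (f 0) = -1 := by omega
  have e2 : b.cartanMatrix (f 0) t = -1 := by omega
  have z1 (j : ℕ) (hj : j < n) (hj0 : j ≠ 0) : b.cartanMatrix t (f j) = 0 := by
    by_contra hne
    exact hj0 (h.1.eq_of_adj ht hj (by omega) hne h0)
  have z2 (j : ℕ) (hj : j < n) (hj0 : j ≠ 0) : b.cartanMatrix (f j) t = 0 :=
    b.cartanMatrix_apply_eq_zero_iff_symm.mp (z1 j hj hj0)
  have y (j : ℕ) (hj : j < n) : b.cartanMatrix (ε t) (f j) = b.cartanMatrix t (f (n - 1 - j)) ∧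
      b.cartanMatrix (f j) (ε t) = b.cartanMatrix (f (n - 1 - j)) t := by
    have := h.cartanMatrix_apply hεC t (i := n - 1 - j) (by omega)
    rwa [show n - 1 - (n - 1 - j) = j by omega] at this
  have htt' := b.cartanMatrix_apply_eq_zero_iff_symm.mp htt
  set g : ℕ → b.support := fun k ↦ if k = 0 then t else if k ≤ n then f (k - 1) else ε t with hg
  have g0 : g 0 = t := rfl
  have gs (k : ℕ) (hk : k < n) : g (k + 1) = f k := by simp [hg, hk]
  have gl : g (n + 1) = ε t := by simp [hg]
  have hcases (k : ℕ) (hk : k < n + 2) : k = 0 ∨ (∃ l < n, k = l + 1) ∨ k = n + 1 := by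
    rcases k with _ | k
    · exact .inl rfl
    · rcases (show k < n ∨ k = n by omega) with h' | rfl
      · exact .inr (.inl ⟨k, h', rfl⟩)
      · exact .inr (.inr rfl)
  have f1 (j : ℕ) (hj : j < n) : b.cartanMatrix t (f j) = if j = 0 then -1 else 0 := by
    split_ifs with hj0
    · rw [hj0, e1]
    · exact z1 j hj hj0
  have f2 (j : ℕ) (hj : j < n) : b.cartanMatrix (f j) t = if j = 0 then -1 else 0 := by
    split_ifs with hj0
    · rw [hj0, e2]
    · exact z2 j hj hj0
  refine ⟨g, fun i j hi hj ↦ ?_, fun i hi ↦ ?_⟩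
  · rcases hcases i hi with rfl | ⟨i, hi', rfl⟩ | rfl <;>
    rcases hcases j hj with rfl | ⟨j, hj', rfl⟩ | rfl
    · simp
    · rw [g0, gs j hj', f1 j hj']
      clear * - hi hj hn
      split_ifs <;> lia
    · rw [g0, gl, htt, if_neg (by omega), if_neg (by omega)]
    · rw [g0, gs i hi', f2 i hi']
      clear * - hi hj hn
      split_ifs <;> lia
    · rw [gs i hi', gs j hj', h.1 i j hi' hj']
      clear * - hi hj hn
      split_ifs <;> omega
    · rw [gs i hi', gl, (y i hi').2, f2 _ (by omega)]
      clear * - hi'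
      split_ifs <;> omega
    · rw [g0, gl, htt', if_neg (by omega), if_neg (by omega)]
    · rw [gs j hj', gl, (y j hj').1, f1 _ (by omega)]
      clear * - hj'
      split_ifs <;> omega
    · simp
  · rcases hcases i hi with rfl | ⟨i, hi', rfl⟩ | rfl
    · exact gl.symm
    · rw [gs i hi', h.2 i hi', show n + 2 - 1 - (i + 1) = n - 1 - i + 1 by omega, gs _ (by omega)]
    · rw [gl, hε, show n + 2 - 1 - (n + 1) = 0 by omega, g0]

/-- A simple root adjacent to a symmetric path that cannot be prolonged is fixed by the symmetry
and adjacent to the middle of the path. -/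
lemma fixed_of_adj (hn : 2 ≤ n) (hmax : ¬ ∃ g, b.IsSymmPathA ε g (n + 2)) {t : b.support}
    (ht : ∀ l < n, f l ≠ t) {i : ℕ} (hi : i < n) (hti : b.cartanMatrix t (f i) ≠ 0) :
    ε t = t ∧ 2 * i + 1 = n := by
  have ht' := h.apply_ne hε ht
  have hC := h.cartanMatrix_apply hεC t hi
  have hlt := cartanMatrix_lt_zero (ht i hi).symm hti
  by_cases htε : ε t = t
  · refine ⟨htε, ?_⟩
    rw [htε] at hC
    have := h.1.eq_of_adj ht hi (j := n - 1 - i) (by omega) hti (by omega)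
    omega
  exfalso
  by_cases htt : b.cartanMatrix t (ε t) = 0
  · rcases Nat.eq_zero_or_pos i with rfl | hi0
    · exact hmax (h.exists_prolongation hε hεC hn ht htε htt hti)
    rcases eq_or_ne i (n - 1) with rfl | hin
    · rw [Nat.sub_self] at hC
      refine hmax (h.exists_prolongation hε hεC hn ht' ?_ ?_ ?_)
      · rw [hε]
        exact Ne.symm htε
      · rw [hε]
        exact b.cartanMatrix_apply_eq_zero_iff_symm.mp htt
      · rw [hC.1]
        exact hti
    · -- a configuration of type `D̃`
      obtain ⟨γ, hγ, H⟩ := h.1.exists_contraction (i := min i (n - 1 - i)) (j := max i (n - 1 - i))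
        (by omega) (by omega)
      have H1 := (H t fun l _ hl ↦ ht l (by omega)).1 i (by omega) (by omega)
      have H2 := (H (ε t) fun l _ hl ↦ ht' l (by omega)).1 (n - 1 - i) (by omega) (by omega)
      have H3 := (H (f (min i (n - 1 - i) - 1)) fun l _ hl he ↦ by
        have := h.1.eq_of_eq (by omega) (by omega) he
        omega).1 (min i (n - 1 - i)) (by omega) (by omega)
      have H4 := (H (f (max i (n - 1 - i) + 1)) fun l _ hl he ↦ by
        have := h.1.eq_of_eq (by omega) (by omega) he
        omega).1 (max i (n - 1 - i)) (by omega) (by omega)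
      rw [h.1 _ _ (by omega) (by omega), if_neg (by omega), if_pos (by omega)] at H3 H4
      refine false_of_four_neighbors hγ (t₁ := t) (t₂ := ε t) (t₃ := f (min i (n - 1 - i) - 1))
        (t₄ := f (max i (n - 1 - i) + 1)) ?_ (by omega) (by omega) (by omega) (by omega)
      have d1 := ht (min i (n - 1 - i) - 1) (by omega)
      have d2 := ht (max i (n - 1 - i) + 1) (by omega)
      have d3 := ht' (min i (n - 1 - i) - 1) (by omega)
      have d4 := ht' (max i (n - 1 - i) + 1) (by omega)
      have d5 : f (min i (n - 1 - i) - 1) ≠ f (max i (n - 1 - i) + 1) := fun he ↦ by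
        have := h.1.eq_of_eq (by omega) (by omega) he
        omega
      simp only [List.nodup_cons, List.mem_cons, not_or, List.not_mem_nil, not_false_iff,
        and_true, List.nodup_nil]
      exact ⟨⟨Ne.symm htε, d1.symm, d2.symm⟩, ⟨d3.symm, d4.symm⟩, d5⟩
  · obtain ⟨γ, hγ, H⟩ := h.1.exists_contraction (i := min i (n - 1 - i)) (j := max i (n - 1 - i))
      (by omega) (by omega)
    have H1 := (H t fun l _ hl ↦ ht l (by omega)).1 i (by omega) (by omega)
    have H2 := (H (ε t) fun l _ hl ↦ ht' l (by omega)).1 (n - 1 - i) (by omega) (by omega)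
    exact false_of_triangle hγ (t := t) (t' := ε t) (by omega) (by omega)
      (cartanMatrix_lt_zero (Ne.symm htε) htt).1

end IsSymmPathA

end RootPairing.Base

namespace RootPairing.Base

variable {ι R M N : Type*} [Finite ι] [Field R] [CharZero R]
  [AddCommGroup M] [Module R M] [AddCommGroup N] [Module R N]
  {P : RootPairing ι R M N} [P.IsCrystallographic] [P.IsReduced]
  {b : P.Base} [P.IsRootSystem]

/-! ### The Dynkin diagram is a tree -/

variable (b) in
/-- The graph underlying the Dynkin diagram. -/
def dynkinGraph : SimpleGraph b.support where
  Adj i j := i ≠ j ∧ b.cartanMatrix i j ≠ 0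
  symm := ⟨fun _ _ h ↦ ⟨h.1.symm, mt b.cartanMatrix_apply_eq_zero_iff_symm.mpr h.2⟩⟩
  loopless := ⟨fun _ h ↦ h.1 rfl⟩

lemma dynkinGraph_connected [P.IsIrreducible] [Nonempty b.support] : b.dynkinGraph.Connected := by
  refine ⟨fun i j ↦ ?_⟩
  refine b.induction_on_cartanMatrix (b.dynkinGraph.Reachable i) (i := i) (j := j) (.refl _)
    fun k l hk hkl ↦ ?_
  by_cases hne : k = l
  · exact hne ▸ hk
  · exact hk.trans (SimpleGraph.Adj.reachable (G := b.dynkinGraph)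
      ⟨hne, mt b.cartanMatrix_apply_eq_zero_iff_symm.mpr hkl⟩)

lemma dynkinGraph_isAcyclic : b.dynkinGraph.IsAcyclic := by
  classical
  intro v c hc
  let g : {x // x ∈ c.support} → ι := fun x ↦ (x : b.support)
  have : Nonempty {x // x ∈ c.support} := ⟨⟨v, c.start_mem_support⟩⟩
  obtain ⟨k, hk⟩ := exists_sum_pairingIn_pos (b := b) (g := g) (fun x ↦ b.isPos_simple x)
    (x := fun _ ↦ 1) (fun _ ↦ one_pos)
  obtain ⟨l₁, l₂, hne, hl⟩ := Set.ncard_eq_two.mp (hc.ncard_neighborSet_toSubgraph_eq_two k.2)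
  have hmem (l : b.support) (h : l ∈ c.toSubgraph.neighborSet k) :
      l ∈ c.support ∧ b.cartanMatrix l k < 0 ∧ l ≠ k := by
    have h1 : c.toSubgraph.Adj k l := h
    have h2 : b.dynkinGraph.Adj k l := h1.adj_sub
    exact ⟨(c.mem_verts_toSubgraph).mp h1.snd_mem, (cartanMatrix_lt_zero h2.1 h2.2).2, h2.1.symm⟩
  obtain ⟨m1, c1, d1⟩ := hmem l₁ (by simp [hl])
  obtain ⟨m2, c2, d2⟩ := hmem l₂ (by simp [hl])
  have hle : ∑ l, 1 * P.pairingIn ℤ (g l) (g k) ≤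
      ∑ l ∈ ({k, ⟨l₁, m1⟩, ⟨l₂, m2⟩} : Finset {x // x ∈ c.support}),
        1 * P.pairingIn ℤ (g l) (g k) := by
    rw [← neg_le_neg_iff, ← Finset.sum_neg_distrib, ← Finset.sum_neg_distrib]
    refine Finset.sum_le_sum_of_subset_of_nonneg (Finset.subset_univ _) fun l _ hl ↦ ?_
    have hlk : (l : b.support) ≠ k := by
      intro e
      simp [Subtype.ext e] at hl
    have := b.cartanMatrix_le_zero_of_ne l k hlk
    change b.cartanMatrix (l : b.support) k ≤ 0 at this
    change 0 ≤ -(1 * b.cartanMatrix (l : b.support) k)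
    lia
  have hk' : k ∉ ({⟨l₁, m1⟩, ⟨l₂, m2⟩} : Finset {x // x ∈ c.support}) := by
    rw [Finset.mem_insert, Finset.mem_singleton]
    rintro (e | e)
    · exact d1 (congrArg Subtype.val e).symm
    · exact d2 (congrArg Subtype.val e).symm
  rw [Finset.sum_insert hk',
    Finset.sum_pair fun e ↦ hne (congrArg Subtype.val e)] at hle
  change _ ≤ 1 * b.cartanMatrix (k : b.support) k + (1 * b.cartanMatrix l₁ k +
    1 * b.cartanMatrix l₂ k) at hle
  rw [cartanMatrix_apply_same] at hle
  lia

variable {ε : Equiv.Perm b.support} (hε : ∀ i, ε (ε i) = i)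
  (hεC : ∀ i j, b.cartanMatrix (ε i) (ε j) = b.cartanMatrix i j)
include hε hεC

/-- The path from a simple root to its image under a symmetry is itself symmetric, because paths in
a tree are unique. -/
lemma exists_symmetric_edge_or_fixed [P.IsIrreducible] (hne : ∃ a, ε a ≠ a) :
    (∃ a, ε a ≠ a ∧ b.cartanMatrix a (ε a) ≠ 0) ∨
      ∃ a c, ε a ≠ a ∧ ε c = c ∧ b.cartanMatrix c a ≠ 0 := by
  obtain ⟨a, ha⟩ := hne
  have : Nonempty b.support := ⟨a⟩
  let φ : b.dynkinGraph →g b.dynkinGraph :=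
    { toFun := ε
      map_rel' := fun {i j} h ↦ ⟨ε.injective.ne h.1, by rw [hεC]; exact h.2⟩ }
  obtain ⟨p, hp⟩ := (dynkinGraph_connected (b := b)).exists_isPath a (ε a)
  have hsymm : p = (p.map φ).reverse.copy (hε a) rfl := by
    have hq : ((p.map φ).reverse.copy (hε a) rfl).IsPath := by
      rw [SimpleGraph.Walk.isPath_copy]
      exact (hp.map ε.injective).reverse
    have := dynkinGraph_isAcyclic.subsingleton_path a (ε a)
    exact congrArg Subtype.val (Subsingleton.elim (⟨p, hp⟩ : b.dynkinGraph.Path a (ε a)) ⟨_, hq⟩)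
  have hv (i : ℕ) : p.getVert i = ε (p.getVert (p.length - i)) := by
    nth_rewrite 1 [hsymm]
    simp [SimpleGraph.Walk.getVert_reverse]
    rfl
  have hlen : 0 < p.length := by
    by_contra h0
    exact ha (SimpleGraph.Walk.eq_of_length_eq_zero (by lia : p.length = 0)).symm
  have hinj (i j : ℕ) (hi : i ≤ p.length) (hj : j ≤ p.length)
      (hij : p.getVert i = p.getVert j) : i = j := hp.getVert_injOn hi hj hij
  obtain ⟨m, hm | hm⟩ := p.length.even_or_odd'
  · right
    have hc := hv m
    rw [hm, show 2 * m - m = m by lia] at hc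
    have h1 := hv (m - 1)
    rw [hm, show 2 * m - (m - 1) = m + 1 by lia] at h1
    refine ⟨p.getVert (m + 1), p.getVert m, ?_, hc.symm, ?_⟩
    · rw [← h1]
      intro h
      have := hinj _ _ (by lia) (by lia) h
      lia
    · exact (p.adj_getVert_succ (by lia)).2
  · left
    have h1 := hv m
    rw [hm, show 2 * m + 1 - m = m + 1 by lia] at h1
    refine ⟨p.getVert (m + 1), ?_, ?_⟩
    · rw [← h1]
      intro h
      have := hinj _ _ (by lia) (by lia) h
      lia
    · rw [← h1]
      exact (p.adj_getVert_succ (by lia)).symm.2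

/-- The middle of a symmetric path from a moved simple root to its image is of type `A₂` or `A₃`. -/
lemma exists_isSymmPathA [P.IsIrreducible] (hne : ∃ a, ε a ≠ a) :
    ∃ f n, 2 ≤ n ∧ b.IsSymmPathA ε f n := by
  have hedge (a : b.support) (ha : ε a ≠ a) (h : b.cartanMatrix a (ε a) ≠ 0) :
      ∃ f n, 2 ≤ n ∧ b.IsSymmPathA ε f n := by
    have h1 : b.cartanMatrix (ε a) a = b.cartanMatrix a (ε a) := by
      rw [← hεC, hε]
    have h2 := (cartanMatrix_eq_zero_or_of_eq_symm ha h1).resolve_left (h1 ▸ h)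
    have h3 := h1.symm.trans h2
    refine ⟨fun k ↦ if k = 0 then a else ε a, 2, le_rfl, fun i j hi hj ↦ ?_, fun i hi ↦ ?_⟩
    · interval_cases i <;> interval_cases j <;> simp [h2, h3]
    · interval_cases i <;> simp [hε]
  rcases exists_symmetric_edge_or_fixed hε hεC hne with ⟨a, ha, h⟩ | ⟨a, c, ha, hc, h⟩
  · exact hedge a ha h
  by_cases h0 : b.cartanMatrix a (ε a) = 0
  swap
  · exact hedge a ha h0
  have h0' := b.cartanMatrix_apply_eq_zero_iff_symm.mp h0
  have hca : c ≠ a := fun e ↦ ha (e ▸ hc)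
  have h1 := cartanMatrix_lt_zero hca h
  have e1 : b.cartanMatrix c (ε a) = b.cartanMatrix c a := by rw [← hεC, hε, hc]
  have e2 : b.cartanMatrix (ε a) c = b.cartanMatrix a c := by rw [← hεC, hε, hc]
  have := pairingIn_of_two_neighbors (b.isPos_simple c) ha.symm h1.1 (e1.symm ▸ h1.1 :)
  change (b.cartanMatrix c a = -1 ∨ b.cartanMatrix c (ε a) = -1) ∧
    (b.cartanMatrix a c = -1 ∨ b.cartanMatrix (ε a) c = -1) at this
  rw [e1, e2, or_self, or_self] at this
  refine ⟨fun k ↦ if k = 0 then a else if k = 1 then c else ε a, 3, by lia, fun i j hi hj ↦ ?_,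
    fun i hi ↦ ?_⟩
  · interval_cases i <;> interval_cases j <;> simp [*]
  · interval_cases i <;> simp [*]

/-- Maximality refers to symmetric paths of the next length `n + 2`, not only to prolongations of `f`. -/
lemma exists_maximal_isSymmPathA [P.IsIrreducible] (hne : ∃ a, ε a ≠ a) :
    ∃ f n, 2 ≤ n ∧ b.IsSymmPathA ε f n ∧ ¬ ∃ g, b.IsSymmPathA ε g (n + 2) := by
  by_contra! hcon
  obtain ⟨f, n, hn, h⟩ := exists_isSymmPathA hε hεC hne
  have key (k : ℕ) : ∃ f, b.IsSymmPathA ε f (n + 2 * k) := by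
    induction k with
    | zero => exact ⟨f, h⟩
    | succ k ih =>
      obtain ⟨f, hf⟩ := ih
      exact hcon f _ (by lia) hf
  obtain ⟨g, hg⟩ := key (Nat.card b.support)
  have := hg.1.le_card
  lia

end RootPairing.Base

namespace RootPairing.Base

variable {ι R M N : Type*} [Finite ι] [Field R] [CharZero R]
  [AddCommGroup M] [Module R M] [AddCommGroup N] [Module R N]
  {P : RootPairing ι R M N} [P.IsCrystallographic] [P.IsReduced]
  {b : P.Base} [P.IsRootSystem]

/-! ### Dynkin diagrams with a non-trivial symmetry -/

lemma exists_equiv_of_cartanMatrix_eq {r : ℕ} {C : Matrix (Fin r) (Fin r) ℤ}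
    (hC : ∀ i j, C i j = 2 → i = j) {v : Fin r → b.support} (hv : v.Surjective)
    (h : ∀ i j, b.cartanMatrix (v i) (v j) = C i j) :
    ∃ e : b.support ≃ Fin r, (∀ i, e.symm i = v i) ∧
      ∀ i j, b.cartanMatrix i j = C (e i) (e j) := by
  have hinj : v.Injective := fun i j hij ↦ hC i j (by rw [← h, hij, cartanMatrix_apply_same])
  exact ⟨(Equiv.ofBijective v ⟨hinj, hv⟩).symm, fun _ ↦ rfl, fun i j ↦ by
    simp only [← h, ← Equiv.ofBijective_apply v ⟨hinj, hv⟩, Equiv.apply_symm_apply]⟩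

lemma forall_of_forall_adj [P.IsIrreducible] (p : b.support → Prop) {i : b.support} (hi : p i)
    (hp : ∀ i j, p i → ¬ p j → b.cartanMatrix j i = 0) (j : b.support) : p j :=
  b.induction_on_cartanMatrix p hi fun i j hi hij ↦ by
    by_contra hj
    exact hij (hp i j hi hj)

lemma IsPathA.hasCartanType {f : ℕ → b.support} {n : ℕ} (h : b.IsPathA f n)
    (hf : ∀ x, ∃ l < n, f l = x) : b.HasCartanType (CartanMatrix.A n) := by
  have h1 : ∀ i j, CartanMatrix.A n i j = 2 → i = j := by
    intro i j
    simp only [CartanMatrix.A, Matrix.of_apply]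
    grind
  obtain ⟨e, -, he⟩ := exists_equiv_of_cartanMatrix_eq (b := b) h1 (v := fun i : Fin n ↦ f i)
    (fun x ↦ (hf x).elim fun l hl ↦ ⟨⟨l, hl.1⟩, hl.2⟩) fun i j ↦ by
      rw [h i j i.2 j.2]
      simp [CartanMatrix.A, Fin.ext_iff]
  exact ⟨e, he⟩

lemma D_apply_eq {k : ℕ} (hk : 2 ≤ k) (i j : Fin (k + 2)) : CartanMatrix.D (k + 2) i j =
    if (i : ℕ) < k then
      if (j : ℕ) < k then if (i : ℕ) = j then 2 else if (i : ℕ) + 1 = j ∨ (j : ℕ) + 1 = i then -1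
        else 0
      else if (i : ℕ) + 1 = k then -1 else 0
    else if (j : ℕ) < k then if (j : ℕ) + 1 = k then -1 else 0
    else if (i : ℕ) = j then 2 else 0 := by
  obtain ⟨i, hi⟩ := i
  obtain ⟨j, hj⟩ := j
  simp only [CartanMatrix.D, Matrix.of_apply, Fin.mk.injEq]
  grind (splits := 20)

/-- The diagram of type `D`, numbered from the end of the path. -/
lemma IsPathA.exists_equiv_D {g : ℕ → b.support} {k : ℕ} (hg : b.IsPathA g k) (hk : 2 ≤ k)
    {p q : b.support}
    (hp : ∀ i < k, b.cartanMatrix (g i) p = (if i = 0 then -1 else 0) ∧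
      b.cartanMatrix p (g i) = if i = 0 then -1 else 0)
    (hq : ∀ i < k, b.cartanMatrix (g i) q = (if i = 0 then -1 else 0) ∧
      b.cartanMatrix q (g i) = if i = 0 then -1 else 0)
    (hpq : b.cartanMatrix p q = 0) (hqp : b.cartanMatrix q p = 0)
    (hcov : ∀ x, x = p ∨ x = q ∨ ∃ l < k, g l = x) :
    ∃ e : b.support ≃ Fin (k + 2),
      (∀ i j, b.cartanMatrix i j = CartanMatrix.D (k + 2) (e i) (e j)) ∧
      (∀ i : Fin (k + 2), (i : ℕ) = k → e.symm i = p) ∧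
      ∀ i : Fin (k + 2), (i : ℕ) = k + 1 → e.symm i = q := by
  let v : Fin (k + 2) → b.support := fun i ↦
    if (i : ℕ) < k then g (k - 1 - i) else if (i : ℕ) = k then p else q
  have v1 (i : Fin (k + 2)) (hi : (i : ℕ) < k) : v i = g (k - 1 - i) := if_pos hi
  have v2 (i : Fin (k + 2)) (hi : (i : ℕ) = k) : v i = p :=
    (if_neg (by omega)).trans (if_pos hi)
  have v3 (i : Fin (k + 2)) (hi : (i : ℕ) = k + 1) : v i = q :=
    (if_neg (by omega)).trans (if_neg (by omega))
  have hv : v.Surjective := by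
    intro x
    rcases hcov x with rfl | rfl | ⟨l, hl, rfl⟩
    · exact ⟨⟨k, by omega⟩, v2 _ rfl⟩
    · exact ⟨⟨k + 1, by omega⟩, v3 _ rfl⟩
    · refine ⟨⟨k - 1 - l, by omega⟩, (v1 _ (by dsimp only; omega)).trans ?_⟩
      congr 1
      dsimp only
      omega
  have hD : ∀ i j, CartanMatrix.D (k + 2) i j = 2 → i = j := by
    intro i j
    simp only [CartanMatrix.D, Matrix.of_apply]
    grind
  obtain ⟨e, he, heC⟩ := exists_equiv_of_cartanMatrix_eq hD hv fun i j ↦ by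
    rw [D_apply_eq hk]
    rcases (show (i : ℕ) < k ∨ (i : ℕ) = k ∨ (i : ℕ) = k + 1 by omega) with hi | hi | hi <;>
    rcases (show (j : ℕ) < k ∨ (j : ℕ) = k ∨ (j : ℕ) = k + 1 by omega) with hj | hj | hj
    · rw [v1 i hi, v1 j hj, hg _ _ (by omega) (by omega), if_pos hi, if_pos hj]
      refine if_congr (by omega) rfl (if_congr (by omega) rfl rfl)
    · rw [v1 i hi, v2 j hj, (hp (k - 1 - i) (by omega)).1, if_pos hi,
        if_neg (show ¬ (j : ℕ) < k by omega)]
      exact if_congr (by omega) rfl rfl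
    · rw [v1 i hi, v3 j hj, (hq (k - 1 - i) (by omega)).1, if_pos hi,
        if_neg (show ¬ (j : ℕ) < k by omega)]
      exact if_congr (by omega) rfl rfl
    · rw [v2 i hi, v1 j hj, (hp (k - 1 - j) (by omega)).2,
        if_neg (show ¬ (i : ℕ) < k by omega), if_pos hj]
      exact if_congr (by omega) rfl rfl
    · rw [v2 i hi, v2 j hj, cartanMatrix_apply_same, if_neg (by omega), if_neg (by omega),
        if_pos (by omega)]
    · rw [v2 i hi, v3 j hj, hpq, if_neg (by omega), if_neg (by omega), if_neg (by omega)]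
    · rw [v3 i hi, v1 j hj, (hq (k - 1 - j) (by omega)).2,
        if_neg (show ¬ (i : ℕ) < k by omega), if_pos hj]
      exact if_congr (by omega) rfl rfl
    · rw [v3 i hi, v2 j hj, hqp, if_neg (by omega), if_neg (by omega), if_neg (by omega)]
    · rw [v3 i hi, v3 j hj, cartanMatrix_apply_same, if_neg (by omega), if_neg (by omega),
        if_pos (by omega)]
  exact ⟨e, heC, fun i hi ↦ (he i).trans (v2 i hi), fun i hi ↦ (he i).trans (v3 i hi)⟩

variable {ε : Equiv.Perm b.support} (hε : ∀ i, ε (ε i) = i)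
  (hεC : ∀ i j, b.cartanMatrix (ε i) (ε j) = b.cartanMatrix i j)
  {f : ℕ → b.support} {n : ℕ} (hn : 2 ≤ n) (h : b.IsSymmPathA ε f n)
  (hmax : ¬ ∃ g, b.IsSymmPathA ε g (n + 2))
  {t : b.support} (ht : ∀ l < n, f l ≠ t) {m : ℕ} (hm : m < n)
  (htm : b.cartanMatrix t (f m) ≠ 0)

namespace IsSymmPathA

include hε hεC hn h hmax ht hm htm

/-- Two neighbours of the middle outside the path would give a configuration of type `D̃₄`. -/
lemma eq_of_adj_of_adj {t' : b.support} (ht' : ∀ l < n, f l ≠ t') {m' : ℕ} (hm' : m' < n)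
    (htm' : b.cartanMatrix t' (f m') ≠ 0) : t = t' := by
  obtain ⟨-, h1⟩ := h.fixed_of_adj hε hεC hn hmax ht hm htm
  obtain ⟨-, h2⟩ := h.fixed_of_adj hε hεC hn hmax ht' hm' htm'
  obtain rfl : m = m' := by omega
  by_contra hne
  have e1 := h.1 m (m - 1) hm (by omega)
  have e2 := h.1 m (m + 1) hm (by omega)
  rw [if_neg (by omega), if_pos (by omega)] at e1 e2
  have e3 := cartanMatrix_lt_zero (ht m hm).symm htm
  have e4 := cartanMatrix_lt_zero (ht' m hm).symm htm'
  refine false_of_four_neighbors (b.isPos_simple (f m)) (t₁ := f (m - 1)) (t₂ := f (m + 1))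
    (t₃ := t) (t₄ := t') ?_ (e1.trans_lt neg_one_lt_zero :)
    (e2.trans_lt neg_one_lt_zero :) e3.2 e4.2
  have d5 : f (m - 1) ≠ f (m + 1) := fun he ↦ by
    have := h.1.eq_of_eq (by omega) (by omega) he
    omega
  simp only [List.nodup_cons, List.mem_cons, not_or, List.not_mem_nil, not_false_iff,
    and_true, List.nodup_nil]
  exact ⟨⟨d5, ht _ (by omega), ht' _ (by omega)⟩, ⟨ht _ (by omega), ht' _ (by omega)⟩, hne⟩

/-- A multiple bond at the middle would give a configuration of type `B̃₃` or its dual. -/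
lemma cartanMatrix_eq_neg_one :
    b.cartanMatrix t (f m) = -1 ∧ b.cartanMatrix (f m) t = -1 := by
  obtain ⟨-, h1⟩ := h.fixed_of_adj hε hεC hn hmax ht hm htm
  have e1 := h.1 m (m - 1) hm (by omega)
  have e2 := h.1 m (m + 1) hm (by omega)
  rw [if_neg (by omega), if_pos (by omega)] at e1 e2
  have e3 := cartanMatrix_lt_zero (ht m hm).symm htm
  have := pairingIn_of_three_neighbors (b.isPos_simple (f m)) (a := f (m - 1)) (a' := f (m + 1))
    (t := t) ?_ (e1.trans_lt neg_one_lt_zero :)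
    (e2.trans_lt neg_one_lt_zero :) e3.2
  · exact this.symm
  have d5 : f (m - 1) ≠ f (m + 1) := fun he ↦ by
    have := h.1.eq_of_eq (by omega) (by omega) he
    omega
  simp only [List.nodup_cons, List.mem_cons, not_or, List.not_mem_nil, not_false_iff,
    and_true, List.nodup_nil]
  exact ⟨⟨d5, ht _ (by omega)⟩, ht _ (by omega)⟩

/-- Otherwise there is a configuration of type `Ẽ₆`. -/
lemma eq_of_adj_of_five_le (hn5 : 5 ≤ n) {t' : b.support} (ht' : ∀ l < n, f l ≠ t')
    (htt' : b.cartanMatrix t' t ≠ 0) : t' = t := by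
  obtain ⟨-, h1⟩ := h.fixed_of_adj hε hεC hn hmax ht hm htm
  by_contra hne
  have e3 := cartanMatrix_lt_zero (ht m hm).symm htm
  have e4 := cartanMatrix_lt_zero hne htt'
  have hC (i : ℕ) (hi : i + 1 < n) : b.cartanMatrix (f i) (f (i + 1)) < 0 := by
    rw [h.1 _ _ (by omega) hi, if_neg (by omega), if_pos (by omega)]
    norm_num
  obtain ⟨m, rfl⟩ : ∃ k, m = k + 2 := ⟨m - 2, by omega⟩
  refine false_of_injective_of_edges
    (v := Fin.cons t' (Fin.cons t (fun i : Fin 5 ↦ f (m + i)) : Fin 6 → b.support))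
    [(0, 1), (1, 4), (2, 3), (3, 4), (4, 5), (5, 6)] ![1, 2, 1, 2, 3, 2, 1] (by decide) (by decide)
    ?_ ?_
  · rw [Fin.cons_injective_iff, Fin.cons_injective_iff]
    refine ⟨?_, ?_, fun i j hij ↦ ?_⟩
    · rintro ⟨i, hi⟩
      refine Fin.cases (fun hi ↦ hne hi.symm) (fun i hi ↦ ht' (m + i) (by omega) hi) i hi
    · rintro ⟨i, hi⟩
      exact ht (m + i) (by omega) hi
    · have := h.1.eq_of_eq (by omega) (by omega) hij
      omega
  · simp only [List.forall_mem_cons]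
    exact ⟨e4.1, e3.1, hC m (by omega), hC (m + 1) (by omega), hC (m + 2) (by omega),
      hC (m + 3) (by omega), by simp⟩

/-- Otherwise there is a configuration of type `Ẽ₇`. -/
lemma lt_seven : n < 7 := by
  obtain ⟨-, h1⟩ := h.fixed_of_adj hε hεC hn hmax ht hm htm
  by_contra hn7
  have e3 := cartanMatrix_lt_zero (ht m hm).symm htm
  have hC (i : ℕ) (hi : i + 1 < n) : b.cartanMatrix (f i) (f (i + 1)) < 0 := by
    rw [h.1 _ _ (by omega) hi, if_neg (by omega), if_pos (by omega)]
    norm_num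
  obtain ⟨m, rfl⟩ : ∃ k, m = k + 3 := ⟨m - 3, by omega⟩
  refine false_of_injective_of_edges
    (v := Fin.cons t (fun i : Fin 7 ↦ f (m + i)))
    [(0, 4), (1, 2), (2, 3), (3, 4), (4, 5), (5, 6), (6, 7)] ![2, 1, 2, 3, 4, 3, 2, 1] (by decide)
    (by decide) ?_ ?_
  · rw [Fin.cons_injective_iff]
    refine ⟨?_, fun i j hij ↦ ?_⟩
    · rintro ⟨i, hi⟩
      exact ht (m + i) (by omega) hi
    · have := h.1.eq_of_eq (by omega) (by omega) hij
      omega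
  · simp only [List.forall_mem_cons]
    exact ⟨e3.1, hC m (by omega), hC (m + 1) (by omega), hC (m + 2) (by omega),
      hC (m + 3) (by omega), hC (m + 4) (by omega), hC (m + 5) (by omega), by simp⟩

lemma hasCartanType_E₆ [P.IsIrreducible] (hn5 : 5 ≤ n) : b.HasCartanType CartanMatrix.E₆ := by
  have hn7 := h.lt_seven hε hεC hn hmax ht hm htm
  obtain ⟨-, h1⟩ := h.fixed_of_adj hε hεC hn hmax ht hm htm
  obtain ⟨e1, e2⟩ := h.cartanMatrix_eq_neg_one hε hεC hn hmax ht hm htm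
  obtain rfl : m = 2 := by omega
  obtain rfl : n = 5 := by omega
  have hcov : ∀ x, x = t ∨ ∃ l < 5, f l = x := by
    refine forall_of_forall_adj _ (.inl rfl) fun x y hx hy ↦ ?_
    push Not at hy
    by_contra hxy
    rcases hx with rfl | ⟨l, hl, rfl⟩
    · exact hy.1 (h.eq_of_adj_of_five_le hε hεC hn hmax ht hm htm hn5 hy.2 hxy)
    · exact hy.1 (h.eq_of_adj_of_adj hε hεC hn hmax ht hm htm hy.2 hl hxy).symm
  have z1 (j : ℕ) (hj : j < 5) (hj2 : j ≠ 2) : b.cartanMatrix t (f j) = 0 := by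
    by_contra hne
    exact hj2 (h.1.eq_of_adj ht hj hm hne htm)
  have z2 (j : ℕ) (hj : j < 5) (hj2 : j ≠ 2) : b.cartanMatrix (f j) t = 0 :=
    b.cartanMatrix_apply_eq_zero_iff_symm.mp (z1 j hj hj2)
  have hA : ∀ i j, i < 5 → j < 5 → b.cartanMatrix (f i) (f j) =
      if i = j then 2 else if i + 1 = j ∨ j + 1 = i then -1 else 0 := h.1
  have hv : (![f 0, t, f 1, f 2, f 3, f 4] : Fin 6 → b.support).Surjective := by
    intro x
    rcases hcov x with rfl | ⟨l, hl, rfl⟩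
    · exact ⟨1, rfl⟩
    · interval_cases l
      exacts [⟨0, rfl⟩, ⟨2, rfl⟩, ⟨3, rfl⟩, ⟨4, rfl⟩, ⟨5, rfl⟩]
  obtain ⟨e, -, he⟩ := exists_equiv_of_cartanMatrix_eq (b := b) (C := CartanMatrix.E₆)
    (fun i j ↦ by fin_cases i <;> fin_cases j <;> simp [CartanMatrix.E₆]) hv fun i j ↦ by
      fin_cases i <;> fin_cases j <;> simp [CartanMatrix.E₆, hA, z1, z2, e1, e2]
  exact ⟨e, he⟩

/-- A diagram of type `A₃` with a further root attached to its middle grows to a diagram that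
consists of the two ends and of a path starting at the middle. -/
lemma exists_tail [P.IsIrreducible] (hn3 : n = 3) :
    ∃ (k : ℕ) (g : ℕ → b.support), 2 ≤ k ∧ b.IsPathA g k ∧ g 0 = f 1 ∧
      (∀ l < k, g l ≠ f 0 ∧ g l ≠ f 2) ∧ ∀ x, x = f 0 ∨ x = f 2 ∨ ∃ l < k, g l = x := by
  subst hn3
  obtain ⟨-, h1⟩ := h.fixed_of_adj hε hεC hn hmax ht hm htm
  obtain rfl : m = 1 := by omega
  -- the tail of the diagram
  let Q (k : ℕ) : Prop := 0 < k ∧ ∃ g : ℕ → b.support, b.IsPathA g k ∧ g 0 = f 1 ∧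
    ∀ l < k, g l ≠ f 0 ∧ g l ≠ f 2
  have hd (i j : ℕ) (hi : i < 3) (hj : j < 3) (hij : i ≠ j) : f i ≠ f j :=
    fun he ↦ hij (h.1.eq_of_eq hi hj he)
  have hQ1 : Q 1 := by
    refine ⟨one_pos, fun _ ↦ f 1, fun i j hi hj ↦ ?_, rfl, fun _ _ ↦
      ⟨hd 1 0 (by omega) (by omega) (by omega), hd 1 2 (by omega) (by omega) (by omega)⟩⟩
    rw [cartanMatrix_apply_same, if_pos (by omega)]
  obtain ⟨k, ⟨hk0, g, hg, hg0, hgne⟩, hkmax⟩ : ∃ k, Q k ∧ ¬ Q (k + 1) := by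
    by_contra! hcon
    have hall (k : ℕ) : Q (k + 1) := by
      induction k with
      | zero => exact hQ1
      | succ k ih => exact hcon _ ih
    obtain ⟨-, g, hg, -⟩ := hall (Nat.card b.support)
    have := hg.le_card
    omega
  have c1 : b.cartanMatrix (g 0) (f 0) = -1 := by
    rw [hg0, h.1 1 0 (by omega) (by omega)]
    simp
  have c2 : b.cartanMatrix (g 0) (f 2) = -1 := by
    rw [hg0, h.1 1 2 (by omega) (by omega)]
    simp
  have d1 (x : b.support) (hx : ∀ l < k, g l ≠ x) (hx0 : x ≠ f 0) (hx2 : x ≠ f 2) :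
      ∀ l < 3, f l ≠ x := by
    intro l hl he
    interval_cases l
    · exact hx0 he.symm
    · exact hx 0 hk0 (hg0.trans he)
    · exact hx2 he.symm
  -- there are no simple roots outside the diagram
  have hcov : ∀ x, x = f 0 ∨ x = f 2 ∨ ∃ l < k, g l = x := by
    refine forall_of_forall_adj _ (.inl rfl) fun x y hx hy ↦ ?_
    push Not at hy
    obtain ⟨hy0, hy2, hyg⟩ := hy
    by_contra hxy
    have hyf := d1 y hyg hy0 hy2
    rcases hx with rfl | rfl | ⟨l, hl, rfl⟩
    · have := (h.fixed_of_adj hε hεC hn hmax hyf (by omega) hxy).2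
      omega
    · have := (h.fixed_of_adj hε hεC hn hmax hyf (by omega) hxy).2
      omega
    have hlt := cartanMatrix_lt_zero (hyg l hl).symm hxy
    obtain ⟨γ, hγ, H⟩ := hg.exists_contraction (Nat.zero_le l) hl
    have H0 := (H (f 0) fun l _ _ ↦ (hgne l (by omega)).1).1 0 le_rfl (by omega)
    have H2 := (H (f 2) fun l _ _ ↦ (hgne l (by omega)).2).1 0 le_rfl (by omega)
    have Hy := (H y fun l _ _ ↦ hyg l (by omega)).1 l (by omega) le_rfl
    have h02 := hd 0 2 (by omega) (by omega) (by omega)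
    rcases (show l + 1 < k ∨ l + 1 = k by omega) with hlk | rfl
    · have H3 := (H (g (l + 1)) fun j _ hj he ↦ by
        have := hg.eq_of_eq (by omega) (by omega) he
        omega).1 l (by omega) le_rfl
      rw [hg _ _ (by omega) (by omega), if_neg (by omega), if_pos (by omega)] at H3
      refine false_of_four_neighbors hγ (t₁ := f 0) (t₂ := f 2) (t₃ := g (l + 1)) (t₄ := y) ?_
        (by omega) (by omega) (by omega) (by omega)
      simp only [List.nodup_cons, List.mem_cons, not_or, List.not_mem_nil, not_false_iff,
        and_true, List.nodup_nil]
      exact ⟨⟨h02, (hgne _ hlk).1.symm, hy0.symm⟩, ⟨(hgne _ hlk).2.symm, hy2.symm⟩, hyg _ hlk⟩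
    · have := pairingIn_of_three_neighbors hγ (a := f 0) (a' := f 2) (t := y) ?_ (by omega)
        (by omega) (by omega)
      swap
      · simp only [List.nodup_cons, List.mem_cons, not_or, List.not_mem_nil, not_false_iff,
          and_true, List.nodup_nil]
        exact ⟨⟨h02, hy0.symm⟩, hy2.symm⟩
      have e1 : b.cartanMatrix (g l) y = -1 := by omega
      have e2 : b.cartanMatrix y (g l) = -1 := by omega
      have z1 (j : ℕ) (hj : j < l) : b.cartanMatrix y (g j) = 0 := by
        by_contra hne
        have := hg.eq_of_adj hyg (by omega) hl hne hxy
        omega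
      have z2 (j : ℕ) (hj : j < l) : b.cartanMatrix (g j) y = 0 :=
        b.cartanMatrix_apply_eq_zero_iff_symm.mp (z1 j hj)
      have f1 (j : ℕ) (hj : j ≤ l) : b.cartanMatrix y (g j) = if j = l then -1 else 0 := by
        split_ifs with hjl
        · rw [hjl, e2]
        · exact z1 j (by omega)
      have f2 (j : ℕ) (hj : j ≤ l) : b.cartanMatrix (g j) y = if j = l then -1 else 0 := by
        split_ifs with hjl
        · rw [hjl, e1]
        · exact z2 j (by omega)
      set G : ℕ → b.support := fun j ↦ if j ≤ l then g j else y with hG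
      have Gle (j : ℕ) (hj : j ≤ l) : G j = g j := if_pos hj
      have Gl : G (l + 1) = y := if_neg (by omega)
      refine hkmax ⟨by omega, G, fun i j hi hj ↦ ?_, (Gle 0 (by omega)).trans hg0, fun j hj ↦ ?_⟩
      · rcases (show i ≤ l ∨ i = l + 1 by omega) with hi' | hi' <;>
        rcases (show j ≤ l ∨ j = l + 1 by omega) with hj' | hj'
        · rw [Gle i hi', Gle j hj', hg i j (by omega) (by omega)]
        · rw [Gle i hi', hj', Gl, f2 i hi']
          clear * - hi'
          split_ifs <;> omega
        · rw [Gle j hj', hi', Gl, f1 j hj']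
          clear * - hj'
          split_ifs <;> omega
        · rw [hi', hj', cartanMatrix_apply_same, if_pos rfl]
      · rcases (show j ≤ l ∨ j = l + 1 by omega) with hj' | hj'
        · rw [Gle j hj']
          exact hgne j (by omega)
        · rw [hj', Gl]
          exact ⟨hy0, hy2⟩
  have htg : ∃ l < k, g l = t := by
    rcases hcov t with ht' | ht' | ht'
    · exact (ht 0 (by omega) ht'.symm).elim
    · exact (ht 2 (by omega) ht'.symm).elim
    · exact ht'
  have hk : 2 ≤ k := by
    obtain ⟨l, hl, hlt⟩ := htg
    have : l ≠ 0 := by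
      rintro rfl
      exact ht 1 (by omega) (hg0.symm.trans hlt)
    omega
  exact ⟨k, g, hk, hg, hg0, hgne, hcov⟩

/-- The numbering is such that the symmetry exchanges the two ends of the fork. -/
lemma exists_equiv_D [P.IsIrreducible] (hn3 : n = 3) :
    ∃ r, 4 ≤ r ∧ ∃ e : b.support ≃ Fin r,
      (∀ i j, b.cartanMatrix i j = CartanMatrix.D r (e i) (e j)) ∧
      ∀ i : Fin r, (i : ℕ) + 2 = r → (e (ε (e.symm i)) : ℕ) + 1 = r := by
  subst hn3
  obtain ⟨k, g, hk, hg, hg0, hgne, hcov⟩ := h.exists_tail hε hεC hn hmax ht hm htm rfl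
  have z1 (i : ℕ) (hi : i < k) (hi0 : i ≠ 0) (m : ℕ) (hm : m < 3) (hm1 : m ≠ 1) :
      b.cartanMatrix (g i) (f m) = 0 := by
    have hgi : ∀ l < 3, f l ≠ g i := by
      intro l hl he
      interval_cases l
      · exact (hgne i hi).1 he.symm
      · exact hi0 (hg.eq_of_eq hi (by omega) (he.symm.trans hg0.symm))
      · exact (hgne i hi).2 he.symm
    by_contra hne
    have := (h.fixed_of_adj hε hεC hn hmax hgi hm hne).2
    omega
  have w1 (i : ℕ) (hi : i < k) (m : ℕ) (hm : m < 3) (hm1 : m ≠ 1) :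
      b.cartanMatrix (g i) (f m) = if i = 0 then -1 else 0 := by
    split_ifs with hi0
    · rw [hi0, hg0, h.1 1 m (by omega) hm, if_neg (by omega), if_pos (by omega)]
    · exact z1 i hi hi0 m hm hm1
  have w2 (i : ℕ) (hi : i < k) (m : ℕ) (hm : m < 3) (hm1 : m ≠ 1) :
      b.cartanMatrix (f m) (g i) = if i = 0 then -1 else 0 := by
    split_ifs with hi0
    · rw [hi0, hg0, h.1 m 1 hm (by omega), if_neg (by omega), if_pos (by omega)]
    · exact b.cartanMatrix_apply_eq_zero_iff_symm.mp (z1 i hi hi0 m hm hm1)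
  obtain ⟨e, heC, e1, e2⟩ := hg.exists_equiv_D hk (p := f 0) (q := f 2)
    (fun i hi ↦ ⟨w1 i hi 0 (by omega) (by omega), w2 i hi 0 (by omega) (by omega)⟩)
    (fun i hi ↦ ⟨w1 i hi 2 (by omega) (by omega), w2 i hi 2 (by omega) (by omega)⟩)
    (h.1 0 2 (by omega) (by omega)) (h.1 2 0 (by omega) (by omega)) hcov
  refine ⟨k + 2, by omega, e, heC, fun i hi ↦ ?_⟩
  rw [e1 i (by omega), h.2 0 (by omega), ← e2 ⟨k + 1, by omega⟩ rfl, Equiv.apply_symm_apply]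

end IsSymmPathA

end RootPairing.Base

namespace RootPairing.Base

variable {ι R M N : Type*} [Finite ι] [Field R] [CharZero R]
  [AddCommGroup M] [Module R M] [AddCommGroup N] [Module R N]
  {P : RootPairing ι R M N} [P.IsCrystallographic] [P.IsReduced]
  {b : P.Base} {w₀ : P.weylGroup} [P.IsRootSystem]

/-! ### The types with a non-trivial opposition involution -/

/-- In type `D r` with `r` even, `-w₀` cannot exchange the two ends of the fork. -/
lemma odd_of_D (hw₀ : b.IsLongest w₀) {r : ℕ} (hr : 4 ≤ r) (e : b.support ≃ Fin r)
    (he : ∀ i j, b.cartanMatrix i j = CartanMatrix.D r (e i) (e j))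
    (hswap : ∀ i : Fin r, (i : ℕ) + 2 = r → (e (simpleOpposition hw₀ (e.symm i)) : ℕ) + 1 = r) :
    Odd r := by
  by_contra hodd
  rw [Nat.not_odd_iff_even] at hodd
  -- twice a half-spin weight, modulo `2`
  let F (j : ℕ) : ℤ := if Even j then 1 else 0
  have h1 := dvd_add_of_cartanMatrix_eq hw₀ e he 2 (fun j ↦ F j) (fun i ↦ ?_) ⟨r - 2, by omega⟩
  · have h2 := hswap ⟨r - 2, by omega⟩ (by dsimp only; omega)
    simp only [F] at h1
    rw [if_neg (by grind), if_pos (by grind)] at h1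
    omega
  · have hi := i.2
    rw [sum_mul_D hr F]
    simp only [F]
    grind

/-- The classification of the Dynkin diagrams on which `-w₀` acts non-trivially. -/
theorem hasCartanType_of_not_forall_smul_eq_neg [P.IsIrreducible] (hw₀ : b.IsLongest w₀)
    (h : ¬ ∀ x : M, w₀ • x = -x) :
    (∃ r, 2 ≤ r ∧ b.HasCartanType (CartanMatrix.A r)) ∨
      (∃ r, 4 ≤ r ∧ Odd r ∧ b.HasCartanType (CartanMatrix.D r)) ∨
      b.HasCartanType CartanMatrix.E₆ := by
  rw [forall_smul_eq_neg_iff hw₀, not_forall] at h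
  have hε := simpleOpposition_simpleOpposition hw₀
  have hεC := cartanMatrix_simpleOpposition hw₀
  obtain ⟨f, n, hn, hf, hmax⟩ := exists_maximal_isSymmPathA hε hεC h
  by_cases hcov : ∀ x, ∃ l < n, f l = x
  · exact .inl ⟨n, hn, hf.1.hasCartanType hcov⟩
  obtain ⟨t, m, ht, hm, htm⟩ : ∃ t m, (∀ l < n, f l ≠ t) ∧ m < n ∧ b.cartanMatrix t (f m) ≠ 0 := by
    by_contra! hcon
    refine hcov (forall_of_forall_adj _ ⟨0, by omega, rfl⟩ fun x y ⟨l, hl, hx⟩ hy ↦ ?_)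
    push Not at hy
    rw [← hx]
    exact hcon y l hy hl
  obtain ⟨-, hnm⟩ := hf.fixed_of_adj hε hεC hn hmax ht hm htm
  rcases (show n = 3 ∨ 5 ≤ n by omega) with h3 | h5
  · obtain ⟨r, hr, e, he, hswap⟩ := hf.exists_equiv_D hε hεC hn hmax ht hm htm h3
    exact .inr (.inl ⟨r, hr, odd_of_D hw₀ hr e he hswap, e, he⟩)
  · exact .inr (.inr (hf.hasCartanType_E₆ hε hεC hn hmax ht hm htm h5))

lemma HasCartanType.cartanMatrix_symm {r : ℕ} {C : Matrix (Fin r) (Fin r) ℤ}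
    (h : b.HasCartanType C) (hC : C.IsSymm) (i j : b.support) :
    b.cartanMatrix i j = b.cartanMatrix j i := by
  obtain ⟨e, he⟩ := h
  rw [he, he, hC.apply]

lemma cartanMatrix_symm_of_not_forall_smul_eq_neg [P.IsIrreducible] (hw₀ : b.IsLongest w₀)
    (h : ¬ ∀ x : M, w₀ • x = -x) (i j : b.support) :
    b.cartanMatrix i j = b.cartanMatrix j i := by
  rcases hasCartanType_of_not_forall_smul_eq_neg hw₀ h with ⟨r, -, h⟩ | ⟨r, -, -, h⟩ | h
  · exact h.cartanMatrix_symm (CartanMatrix.A_isSymm r) i j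
  · exact h.cartanMatrix_symm (CartanMatrix.D_isSymm r) i j
  · exact h.cartanMatrix_symm CartanMatrix.E₆_isSymm i j

end RootPairing.Base

open RootPairing.Base in
theorem theorem2 {ι R M N : Type*} [Finite ι] [Field R] [CharZero R]
    [AddCommGroup M] [Module R M] [AddCommGroup N] [Module R N]
    (P : RootPairing ι R M N) [P.IsRootSystem] [P.IsCrystallographic] [P.IsReduced]
    [P.IsIrreducible] (b : P.Base)
    (w₀ : P.weylGroup) (hw₀ : b.IsLongest w₀) :
    b.rationalityGraph.Connected ∧
    b.IsRational w₀ ∧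
    (∃ (ε : Equiv.Perm b.support) (φ : P.weylGroup ≃* P.weylGroup)
        (Φ : b.rationalityGraph ≃g b.rationalityGraph),
      (∀ i : b.support, w₀ • P.root i = -P.root (ε i)) ∧
      (∀ i, ε (ε i) = i) ∧
      (∀ i j, b.cartanMatrix (ε i) (ε j) = b.cartanMatrix i j) ∧
      (∀ i, φ (b.simpleReflection i) = b.simpleReflection (ε i)) ∧
      (∀ u, (Φ u : P.weylGroup) = φ u) ∧
      (∀ u, Φ (Φ u) = u) ∧
      (∀ u, Φ u = u ↔ (u : P.weylGroup) = w₀)) ∧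
    (Nontrivial {u : P.weylGroup // b.IsRational u} ↔ ¬ ∀ x : M, w₀ • x = -x) ∧
    ((¬ ∀ x : M, w₀ • x = -x) ↔
      (∃ r, 2 ≤ r ∧ b.HasCartanType (CartanMatrix.A r)) ∨
      (∃ r, 4 ≤ r ∧ Odd r ∧ b.HasCartanType (CartanMatrix.D r)) ∨
      b.HasCartanType CartanMatrix.E₆) := by
  refine ⟨rationalityGraph_connected hw₀ (cartanMatrix_symm_of_not_forall_smul_eq_neg hw₀),
    isRational_longest hw₀,
    ⟨simpleOpposition hw₀, MulAut.conj w₀, graphOpposition hw₀, fun i ↦ ?_,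
      simpleOpposition_simpleOpposition hw₀, cartanMatrix_simpleOpposition hw₀,
      conj_simpleReflection hw₀, fun _ ↦ rfl, fun u ↦ Subtype.ext (conj_conj hw₀ u), fun u ↦ ?_⟩,
    nontrivial_isRational_iff hw₀, hasCartanType_of_not_forall_smul_eq_neg hw₀, ?_⟩
  · rw [coe_simpleOpposition, root_opposition, neg_neg]
  · rw [Subtype.ext_iff, coe_graphOpposition]
    exact u.2.conj_eq_self_iff hw₀
  · rintro (⟨r, hr, h⟩ | ⟨r, hr, hr', h⟩ | h)
    · exact not_forall_smul_eq_neg_of_A hw₀ hr h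
    · exact not_forall_smul_eq_neg_of_D hw₀ hr hr' h
    · exact not_forall_smul_eq_neg_of_E₆ hw₀ h
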